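/- **Setting.** Let $1\le M<N$. For $n=1,\dots,N$ consider the linear time-invariant process $x_n(t+1)=A_nx_n(t)+w_n(t)$, $y_n(t)=C_nx_n(t)+v_n(t)$, where $w_n(t)$ and $v_n(t)$ are i.i.d. zero-mean Gaussian with covariances $W_n$, $V_n$; the processes are numbered so that $\rho(A_1)^2\ge\dots\ge\rho(A_N)^2$, where $\rho$ denotes the spectral radius. Each process has a local Kalman filter that is stable and in steady state: its posterior error covariance is a constant $\bar P_n\succeq0$ which is a fixed point of the filter recursion, i.e. with $\Sigma_n=A_n\bar P_nA_n^\top+W_n$ the matrix $C_n\Sigma_nC_n^\top+V_n$ is invertible, $K_n=\Sigma_nC_n^\top(C_n\Sigma_nC_n^\top+V_n)^{-1}$ and $\bar P_n=(I-K_nC_n)\Sigma_n$; stability means $\rho((I-K_nC_n)A_n)<1$. The local estimate is $x_n^s(t+1)=A_nx_n^s(t)+K_n\bigl(y_n(t+1)-C_nA_nx_n^s(t)\bigr)$, and $\mathsf E[(x^s_n(0)-x_n(0))(x^s_n(0)-x_n(0))^\top]=\bar P_n$. There are $M$ frequency channels. Their joint state $h(t)$, $t\ge0$, is an irreducible aperiodic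 Markov chain on a set $\mathcal S=\{h_1,\dots,h_{\bar M}\}\subseteq\{0,1\}^M$ of $\bar M$ distinct vectors $h_j=(h_{j,1},\dots,h_{j,M})$, with transition probabilities $p_{i,j}$ and an arbitrary initial law; $h_{j,m}=1$ means that channel $m$ is on (transmission succeeds) in state $h_j$ and $h_{j,m}=0$ that it is off (transmission fails). The channel process, the initial conditions $(x_n(0),x_n^s(0))$ of the different processes, and all noises are mutually independent. In each slot $t\ge1$ a scheduler selects $\nu_n(t)\in\{0,1,\dots,M\}$ for each $n$ ($0$: packet $n$ is not sent), so each packet uses at most one channel, and each channel carries at most one packet ($\nu_n(t)=\nu_{n'}(t)\ne0$ implies $n=n'$). Put $\gamma_n(t)=1$ if $\nu_n(t)\neq0$ and channel $\nu_n(t)$ is on in state $h(t)$, and $\gamma_n(t)=0$ otherwise. The age of information satisfies $\phi_n(1)=1$, and $\phi_n(t+1)=1$ if $\gamma_n(t)=1$, $\phi_n(t+1)=\phi_n(t)+1$ if $\gamma_n(t)=0$. The remote estimate satisfies $\hat x_n(1)=A_nx_n^s(0)$, and $\hat x_n(t+1)=A_nx_n^s(t)$ if $\gamma_n(t)=1$,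 $\hat x_n(t+1)=A_n\hat x_n(t)$ if $\gamma_n(t)=0$. Only the previous channel state is known: a deterministic stationary policy is a map $\pi$ with $(\nu_1(t),\dots,\nu_N(t))=\pi(\phi_1(t),\dots,\phi_N(t),h(t-1))$ that respects the constraints above. The remote estimator is *average mean-square stabilizable* if for some deterministic stationary policy $$\sum_{n=1}^N\limsup_{T\to\infty}\frac1T\sum_{t=1}^T\mathsf E\,\bigl|\hat x_n(t)-x_n(t)\bigr|^2<\infty .$$ For $v\in\{1,\dots,M\}^{\bar M}$ let $E(v)$ be the $\bar M\times\bar M$ packet error probability matrix with entries $[E(v)]_{i,j}=p_{i,j}$ if $h_{j,v_i}=0$ and $[E(v)]_{i,j}=0$ otherwise, and for $L\ge 1$ let $$\lambda_L=\min_{v_1,\dots,v_L\in\{1,\dots,M\}^{\bar M}}\rho\bigl(E(v_1)E(v_2)\cdots E(v_L)\bigr)^{1/L},\qquad \lambda_\infty=\liminf_{L\to\infty}\lambda_L .$$ **Theorem.** One has $\lambda_\infty=\min_{L\ge1}\lambda_L$, and the remote estimator is average mean-square stabilizable if and only if $\rho(A_1)^2\lambda_\infty<1$. -/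

import Mathlib

open MeasureTheory ProbabilityTheory Filter

noncomputable section

namespace RemoteEstimation

/-! ### Linear algebra -/

/-- The spectral radius of a real square matrix: the largest modulus of its complex eigenvalues. -/
def rho {n : Type*} [Fintype n] [DecidableEq n] (B : Matrix n n ℝ) : ℝ :=
  (spectralRadius ℂ (B.map (algebraMap ℝ ℂ))).toReal

/-! ### Processes and local Kalman filters -/

/-- Parameters of an LTI process `x(t+1) = A x(t) + w(t)`, `y(t) = C x(t) + v(t)` with noise
covariances `W`, `V`, together with the posterior error covariance `Pbar` of its local filter. -/
structure LTIProcess where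
  /-- state dimension -/
  l : ℕ
  /-- measurement dimension -/
  r : ℕ
  A : Matrix (Fin l) (Fin l) ℝ
  C : Matrix (Fin r) (Fin l) ℝ
  W : Matrix (Fin l) (Fin l) ℝ
  V : Matrix (Fin r) (Fin r) ℝ
  Pbar : Matrix (Fin l) (Fin l) ℝ

namespace LTIProcess

variable (p : LTIProcess)

/-- Prior error covariance `A P Aᵀ + W` obtained from the posterior error covariance `P`. -/
def priorCov (P : Matrix (Fin p.l) (Fin p.l) ℝ) : Matrix (Fin p.l) (Fin p.l) ℝ :=
  p.A * P * p.A.transpose + p.W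

/-- Innovation covariance `C S Cᵀ + V`, where `S` is the prior error covariance. -/
def innovationCov (P : Matrix (Fin p.l) (Fin p.l) ℝ) : Matrix (Fin p.r) (Fin p.r) ℝ :=
  p.C * p.priorCov P * p.C.transpose + p.V

/-- Kalman gain `S Cᵀ (C S Cᵀ + V)⁻¹`, where `S` is the prior error covariance. -/
def gain (P : Matrix (Fin p.l) (Fin p.l) ℝ) : Matrix (Fin p.l) (Fin p.r) ℝ :=
  p.priorCov P * p.C.transpose * (p.innovationCov P)⁻¹

/-- One step of the posterior error covariance recursion, `P ↦ (1 - K C) S`. -/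
def posteriorCov (P : Matrix (Fin p.l) (Fin p.l) ℝ) : Matrix (Fin p.l) (Fin p.l) ℝ :=
  (1 - p.gain P * p.C) * p.priorCov P

/-- The local Kalman filter is well defined, stable and in steady state: `Pbar` is a fixed point
of the covariance recursion, and the filter error dynamics
`e(t+1) = (1 - K C) A e(t) + noise` are asymptotically stable. -/
structure IsSteadyStable : Prop where
  posSemidef_W : p.W.PosSemidef
  posSemidef_V : p.V.PosSemidef
  posSemidef_Pbar : p.Pbar.PosSemidef
  isUnit_innovation : IsUnit (p.innovationCov p.Pbar)
  fixed : p.posteriorCov p.Pbar = p.Pbar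
  stable : rho ((1 - p.gain p.Pbar * p.C) * p.A) < 1

end LTIProcess

/-! ### The Markov fading channel -/

/-- An `M`-channel binary fading model with `Mbar` states: `isOn j m` tells whether the `m`-th
frequency channel is on (successful transmission) in the `j`-th channel state, and `P` is the
state transition matrix. -/
structure Channel (M Mbar : ℕ) where
  isOn : Fin Mbar → Fin M → Bool
  P : Matrix (Fin Mbar) (Fin Mbar) ℝ

namespace Channel

variable {M Mbar : ℕ} (c : Channel M Mbar)

/-- The channel states are pairwise distinct vectors in `{0,1}^M`, and `P` is the transition
matrix of an irreducible and aperiodic Markov chain. -/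
structure IsErgodic : Prop where
  injective : Function.Injective c.isOn
  stochastic : c.P ∈ Matrix.rowStochastic ℝ (Fin Mbar)
  irreducible : c.P.IsIrreducible
  aperiodic : ∀ i, ∀ d : ℕ, (∀ k : ℕ, 0 < k → 0 < (c.P ^ k) i i → d ∣ k) → d = 1

/-- The packet error probability matrix `E(v)`: the `(i,j)` entry is the probability of moving
from state `i` to state `j` while channel `v i` is off in state `j`. -/
def E (v : Fin Mbar → Fin M) : Matrix (Fin Mbar) (Fin Mbar) ℝ :=
  Matrix.of fun i j => if c.isOn j (v i) then 0 else c.P i j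

/-- `λ_L`, the minimum of `ρ(E(v_1) ⋯ E(v_L))^(1/L)` over the (finitely many) choices of channel
selection vectors `v_1, …, v_L`. -/
def lam (L : ℕ) : ℝ :=
  ⨅ v : Fin L → Fin Mbar → Fin M, rho (List.ofFn fun k => c.E (v k)).prod ^ (1 / (L : ℝ))

/-- `λ_∞`, the lower limit of `λ_L`. -/
def lamInf : ℝ := liminf c.lam atTop

end Channel

/-! ### Scheduling policies and age of information -/

/-- A deterministic stationary policy: from the current AoI vector and the previous channel state
it computes, for every process, the selected frequency channel (`none`: not scheduled). Each
packet thus takes at most one channel. -/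
abbrev Policy (N M Mbar : ℕ) : Type :=
  (Fin N → ℕ) → Fin Mbar → Fin N → Option (Fin M)

/-- Each frequency channel carries at most one packet. -/
def Policy.IsAdmissible {N M Mbar : ℕ} (π : Policy N M Mbar) : Prop :=
  ∀ φ i n n' j, π φ i n = some j → π φ i n' = some j → n = n'

/-- Successful reception of packet `n` in slot `t` along the channel state path `s`, when the
current AoI vector is `φ`. Scheduling starts in slot `1`. -/
def received {N M Mbar : ℕ} (c : Channel M Mbar) (π : Policy N M Mbar) (s : ℕ → Fin Mbar)
    (φ : Fin N → ℕ) : ℕ → Fin N → Prop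
  | 0, _ => False
  | t + 1, n => ∃ j, π φ (s t) n = some j ∧ c.isOn (s (t + 1)) j = true

open Classical in
/-- The AoI vector at time `t` along the channel state path `s`. The remote estimator starts
synchronized with the local filters at time `0`, so that all AoIs are `1` at time `1`. -/
def aoi {N M Mbar : ℕ} (c : Channel M Mbar) (π : Policy N M Mbar) (s : ℕ → Fin Mbar) :
    ℕ → Fin N → ℕ
  | 0 => fun _ => 0
  | t + 1 => fun n =>
      if received c π s (aoi c π s t) t n then 1 else aoi c π s t n + 1

/-! ### The stochastic system -/

/-- The primitive random quantities of the system: channel states `h`, initial process states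
`x0`, initial local estimates `xs0`, process noises `w` and measurement noises `v`. -/
structure Realization {N : ℕ} (p : Fin N → LTIProcess) (Mbar : ℕ) (Ω : Type*) where
  h : ℕ → Ω → Fin Mbar
  x0 : ∀ n, Ω → Fin (p n).l → ℝ
  xs0 : ∀ n, Ω → Fin (p n).l → ℝ
  w : ∀ n, ℕ → Ω → Fin (p n).l → ℝ
  v : ∀ n, ℕ → Ω → Fin (p n).r → ℝ

/-- Labels of the mutually independent sources of randomness. -/
inductive Source (N : ℕ) where
  | channel : Source N
  | initial (n : Fin N) : Source N
  | processNoise (n : Fin N) (t : ℕ) : Source N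
  | measurementNoise (n : Fin N) (t : ℕ) : Source N

namespace Realization

variable {N M Mbar : ℕ} {p : Fin N → LTIProcess} {Ω : Type*}

/-- The σ-algebra generated by a source of randomness. -/
@[reducible] def sigma (R : Realization p Mbar Ω) : Source N → MeasurableSpace Ω
  | .channel => ⨆ t, MeasurableSpace.comap (R.h t) inferInstance
  | .initial n =>
      MeasurableSpace.comap (R.x0 n) inferInstance ⊔ MeasurableSpace.comap (R.xs0 n) inferInstance
  | .processNoise n t => MeasurableSpace.comap (R.w n t) inferInstance
  | .measurementNoise n t => MeasurableSpace.comap (R.v n t) inferInstance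

/-- The probabilistic assumptions: `h` is a Markov chain with transition matrix `c.P` (and an
arbitrary initial law); the noises are zero-mean Gaussian with covariances `W`, `V`; the initial
local estimation error has second moment matrix `Pbar`; all sources are mutually independent. -/
structure IsModel [MeasurableSpace Ω] (R : Realization p Mbar Ω) (c : Channel M Mbar)
    (μ : Measure Ω) : Prop where
  measurable_h : ∀ t, Measurable (R.h t)
  measurable_x0 : ∀ n, Measurable (R.x0 n)
  measurable_xs0 : ∀ n, Measurable (R.xs0 n)
  measurable_w : ∀ n t, Measurable (R.w n t)
  measurable_v : ∀ n t, Measurable (R.v n t)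
  markov : ∀ (s : ℕ → Fin Mbar) (t : ℕ),
    μ {ω | ∀ k ≤ t + 1, R.h k ω = s k}
      = μ {ω | ∀ k ≤ t, R.h k ω = s k} * ENNReal.ofReal (c.P (s t) (s (t + 1)))
  law_w : ∀ n t, HasLaw (fun ω => WithLp.toLp 2 (R.w n t ω)) (multivariateGaussian 0 (p n).W) μ
  law_v : ∀ n t, HasLaw (fun ω => WithLp.toLp 2 (R.v n t ω)) (multivariateGaussian 0 (p n).V) μ
  memLp_initial : ∀ n i, MemLp (fun ω => R.xs0 n ω i - R.x0 n ω i) 2 μ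
  cov_initial : ∀ n i j,
    ∫ ω, (R.xs0 n ω i - R.x0 n ω i) * (R.xs0 n ω j - R.x0 n ω j) ∂μ = (p n).Pbar i j
  indep : iIndep R.sigma μ

variable (R : Realization p Mbar Ω)

/-- Process state `x_n(t)`. -/
def x (n : Fin N) : ℕ → Ω → Fin (p n).l → ℝ
  | 0 => R.x0 n
  | t + 1 => fun ω => (p n).A.mulVec (x n t ω) + R.w n t ω

/-- Measurement `y_n(t)`. -/
def y (n : Fin N) (t : ℕ) (ω : Ω) : Fin (p n).r → ℝ :=
  (p n).C.mulVec (R.x n t ω) + R.v n t ω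

/-- Local (steady-state Kalman filter) estimate `x^s_n(t)`. -/
def xs (n : Fin N) : ℕ → Ω → Fin (p n).l → ℝ
  | 0 => R.xs0 n
  | t + 1 => fun ω =>
      (p n).A.mulVec (xs n t ω) +
        ((p n).gain (p n).Pbar).mulVec
          (R.y n (t + 1) ω - (p n).C.mulVec ((p n).A.mulVec (xs n t ω)))

open Classical in
/-- Remote estimate of the state of process `n` at time `t` under the policy `π`. -/
def xhat (c : Channel M Mbar) (π : Policy N M Mbar) (n : Fin N) : ℕ → Ω → Fin (p n).l → ℝ
  | 0 => R.xs0 n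
  | t + 1 => fun ω =>
      if received c π (fun k => R.h k ω) (aoi c π (fun k => R.h k ω) t) t n then
        (p n).A.mulVec (R.xs n t ω)
      else (p n).A.mulVec (xhat c π n t ω)

/-- Remote estimation error. -/
def err (c : Channel M Mbar) (π : Policy N M Mbar) (n : Fin N) (t : ℕ) (ω : Ω) :
    Fin (p n).l → ℝ :=
  R.xhat c π n t ω - R.x n t ω

/-- The mean-square error `E[Tr (e eᵀ)]` of the remote estimate of process `n` at time `t`. -/
def mse [MeasurableSpace Ω] (c : Channel M Mbar) (μ : Measure Ω) (π : Policy N M Mbar)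
    (n : Fin N) (t : ℕ) : ENNReal :=
  ∫⁻ ω, ENNReal.ofReal (Matrix.vecMulVec (R.err c π n t ω) (R.err c π n t ω)).trace ∂μ

/-- The long-run average mean-square error `J_n`. -/
def J [MeasurableSpace Ω] (c : Channel M Mbar) (μ : Measure Ω) (π : Policy N M Mbar)
    (n : Fin N) : ENNReal :=
  limsup (fun T : ℕ => (∑ t ∈ Finset.Icc 1 T, R.mse c μ π n t) / (T : ENNReal)) atTop

/-- Average mean-square stabilizability by a deterministic stationary policy. -/
def IsStabilizable [MeasurableSpace Ω] (c : Channel M Mbar) (μ : Measure Ω) : Prop :=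
  ∃ π : Policy N M Mbar, π.IsAdmissible ∧ ∑ n, R.J c μ π n < ⊤

end Realization

end RemoteEstimation

end

/-! Row i of E(v) depends on v only through v_i, so the componentwise minimum over v of E(v)y is
attained by a single v. This makes the minimum an order-preserving operator with a Perron-type
theory (`subinvariant_or_superinvariant`, `exists_growth_rate`): there is a number a ≥ 0, one
nonzero x ≥ 0 with a x ≤ E(v) x for all v at once, and for every s > a some v and some y ≥ 1 with
E(v) y ≤ s y. The vector x bounds the spectral radius of every product of L matrices below by a^L;
the vectors y bound that of powers of a single E(v) above. Hence λ_L = a for all L ≥ 1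
(`lam_eq_of_growth_rate`), and so λ_∞ = a.

The estimation problem reduces to ages. The remote error is the local filter error propagated in
open loop for φ steps; the former has second moment `Pbar` at all times, and the ages depend on the
channel alone, which is independent of the noises. So the mean-square error is the mean of the trace
of `errCov` at the age (`mse_eq`). That trace is at least a multiple of the sum of ρ(A)^(2j) over j
< φ when ρ(A) ≥ 1 (`exists_le_trace_errCov`; stability of the filter excludes degeneracy), and at
most a multiple of one plus the sum of s^j over j < φ for any s > ρ(A)² (`exists_trace_errCov_le`).

Necessity (`J_eq_top`): whatever the policy, E[x(h(t)); φ(t+1) > j] ≥ a^j E[x(h(t-j))]. If ρ(A_1)² a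
≥ 1, summing against ρ(A_1)^(2j) bounds the error at time t+1 below by a multiple of the expected
x-occupation of the channel up to time t, which diverges by irreducibility. This covers the critical
case too.

Sufficiency: if all ρ(A_n)² are below a common bound less than 1, nothing need be sent. Otherwise
choose r > ρ(A_1)² and s > a with r s < 1 and serve only the oldest packet, on channel v_i. The
function y_i times the sum over n of K^(rank of n) r^(φ_n) has geometric drift (`exists_drift`): a
failure costs a factor r s on average, while a success lowers the rank of every waiting packet and
gains 1/K. -/

namespace RemoteEstimation

/-! ### Spectral radius: Gelfand and Collatz–Wielandt bounds -/

section SpectralRadius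

variable {n : Type*} [Fintype n] [DecidableEq n]

attribute [local instance] Matrix.linftyOpNormedRing Matrix.linftyOpNormedAlgebra

lemma rho_nonneg (B : Matrix n n ℝ) : 0 ≤ rho B := ENNReal.toReal_nonneg

lemma rho_of_isEmpty [IsEmpty n] (B : Matrix n n ℝ) : rho B = 0 := by
  simp [rho]

lemma spectralRadius_map_ne_top (B : Matrix n n ℝ) :
    spectralRadius ℂ (B.map (algebraMap ℝ ℂ)) ≠ ⊤ := by
  cases isEmpty_or_nonempty n
  · simp
  · exact ((spectrum.spectralRadius_le_nnnorm _).trans_lt ENNReal.coe_lt_top).ne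

lemma exists_vecMul_eq_smul [Nonempty n] (B : Matrix n n ℝ) :
    ∃ ζ : ℂ, ‖ζ‖ = rho B ∧ ∃ z : n → ℂ, z ≠ 0 ∧
      Matrix.vecMul z (B.map (algebraMap ℝ ℂ)) = ζ • z := by
  obtain ⟨ζ, hζ, hr⟩ := spectrum.exists_nnnorm_eq_spectralRadius_of_nonempty
    (spectrum.nonempty_of_isAlgClosed_of_finiteDimensional ℂ (B.map (algebraMap ℝ ℂ)))
  refine ⟨ζ, by rw [rho, ← hr]; simp, ?_⟩
  rw [spectrum.mem_iff, Matrix.isUnit_iff_isUnit_det, isUnit_iff_ne_zero, not_not,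
    ← Matrix.exists_vecMul_eq_zero_iff] at hζ
  obtain ⟨z, hz, h⟩ := hζ
  refine ⟨z, hz, ?_⟩
  rw [Matrix.vecMul_sub, sub_eq_zero] at h
  rw [← h, Algebra.algebraMap_eq_smul_one, Matrix.vecMul_smul, Matrix.vecMul_one]

lemma exists_mulVec_eq_smul [Nonempty n] (B : Matrix n n ℝ) :
    ∃ ζ : ℂ, ‖ζ‖ = rho B ∧ ∃ z : n → ℂ, z ≠ 0 ∧
      Matrix.mulVec (B.map (algebraMap ℝ ℂ)) z = ζ • z := by
  obtain ⟨ζ, hζ, hr⟩ := spectrum.exists_nnnorm_eq_spectralRadius_of_nonempty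
    (spectrum.nonempty_of_isAlgClosed_of_finiteDimensional ℂ (B.map (algebraMap ℝ ℂ)))
  refine ⟨ζ, by rw [rho, ← hr]; simp, ?_⟩
  rw [spectrum.mem_iff, Matrix.isUnit_iff_isUnit_det, isUnit_iff_ne_zero, not_not,
    ← Matrix.exists_mulVec_eq_zero_iff] at hζ
  obtain ⟨z, hz, h⟩ := hζ
  refine ⟨z, hz, ?_⟩
  rw [Matrix.sub_mulVec, sub_eq_zero] at h
  rw [← h, Algebra.algebraMap_eq_smul_one, Matrix.smul_mulVec, Matrix.one_mulVec]

lemma norm_eigenvalue_le_rho (B : Matrix n n ℝ) {ζ : ℂ} {z : n → ℂ} (hz : z ≠ 0)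
    (h : Matrix.vecMul z (B.map (algebraMap ℝ ℂ)) = ζ • z) : ‖ζ‖ ≤ rho B := by
  have hmem : ζ ∈ spectrum ℂ (B.map (algebraMap ℝ ℂ)) := by
    rw [spectrum.mem_iff, Matrix.isUnit_iff_isUnit_det, isUnit_iff_ne_zero, not_not,
      ← Matrix.exists_vecMul_eq_zero_iff]
    refine ⟨z, hz, ?_⟩
    rw [Matrix.vecMul_sub, sub_eq_zero, h, Algebra.algebraMap_eq_smul_one, Matrix.vecMul_smul,
      Matrix.vecMul_one]
  have h1 : (‖ζ‖₊ : ENNReal) ≤ spectralRadius ℂ (B.map (algebraMap ℝ ℂ)) :=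
    le_iSup₂ (f := fun k (_ : k ∈ spectrum ℂ (B.map (algebraMap ℝ ℂ))) => (‖k‖₊ : ENNReal)) ζ hmem
  simpa [rho] using ENNReal.toReal_mono (spectralRadius_map_ne_top B) h1

/-- Gelfand's bound on the entries of the powers of a matrix. -/
lemma exists_abs_pow_apply_le (B : Matrix n n ℝ) {r : ℝ} (hr : rho B < r) :
    ∃ C : ℝ, 0 < C ∧ ∀ k i j, |(B ^ k) i j| ≤ C * r ^ k := by
  have hr0 : 0 < r := (rho_nonneg B).trans_lt hr
  set D := B.map (algebraMap ℝ ℂ) with hD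
  have hlt : spectralRadius ℂ D < ENNReal.ofReal r :=
    (ENNReal.lt_ofReal_iff_toReal_lt (spectralRadius_map_ne_top B)).2 hr
  have hev := (spectrum.pow_nnnorm_pow_one_div_tendsto_nhds_spectralRadius D).eventually_lt_const hlt
  obtain ⟨K, hK⟩ := eventually_atTop.1 hev
  -- Starting at K + 1 keeps k nonzero, so that the k-th root in Gelfand's formula can be undone.
  have hbound : ∀ k, K + 1 ≤ k → ‖D ^ k‖ ≤ r ^ k := by
    intro k hk
    have h1 := (hK k (by omega)).le
    have hk0 : (k : ℝ) ≠ 0 := by norm_cast; omega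
    have h2 := ENNReal.rpow_le_rpow h1 (Nat.cast_nonneg k : (0 : ℝ) ≤ k)
    rw [← ENNReal.rpow_mul, one_div, inv_mul_cancel₀ hk0, ENNReal.rpow_one, ENNReal.rpow_natCast,
      ← ENNReal.ofReal_pow hr0.le] at h2
    have h3 := ENNReal.toReal_mono ENNReal.ofReal_ne_top h2
    rw [ENNReal.toReal_ofReal (by positivity)] at h3
    simpa using h3
  have hentry : ∀ k i j, |(B ^ k) i j| ≤ ‖D ^ k‖ := by
    intro k i j
    have h1 : D ^ k = (B ^ k).map (algebraMap ℝ ℂ) := by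
      rw [hD, Matrix.map_pow]
    have h2 : ‖(D ^ k) i j‖ = |(B ^ k) i j| := by simp [h1]
    rw [← h2, Matrix.linfty_opNorm_def]
    have h3 : ‖(D ^ k) i j‖₊ ≤ ∑ j, ‖(D ^ k) i j‖₊ :=
      Finset.single_le_sum (f := fun j => ‖(D ^ k) i j‖₊) (fun _ _ => zero_le) (Finset.mem_univ j)
    have h4 : ∑ j, ‖(D ^ k) i j‖₊ ≤ Finset.univ.sup fun i => ∑ j, ‖(D ^ k) i j‖₊ :=
      Finset.le_sup (f := fun i => ∑ j, ‖(D ^ k) i j‖₊) (Finset.mem_univ i)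
    exact_mod_cast h3.trans h4
  -- The 1 serves the large powers; each of the finitely many small powers is covered by its own
  -- summand.
  refine ⟨1 + ∑ k ∈ Finset.range (K + 1), ‖D ^ k‖ / r ^ k, by positivity, fun k i j => ?_⟩
  refine (hentry k i j).trans ?_
  have hrk : 0 < r ^ k := by positivity
  by_cases hk : K + 1 ≤ k
  · refine (hbound k hk).trans (le_mul_of_one_le_left hrk.le ?_)
    exact le_add_of_nonneg_right (by positivity)
  · have h1 : ‖D ^ k‖ / r ^ k ≤ ∑ k ∈ Finset.range (K + 1), ‖D ^ k‖ / r ^ k :=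
      Finset.single_le_sum (f := fun k => ‖D ^ k‖ / r ^ k) (fun _ _ => by positivity)
        (Finset.mem_range.2 (by omega))
    rw [← div_le_iff₀ hrk]
    linarith

omit [DecidableEq n] in
lemma mulVec_mono {B : Matrix n n ℝ} (hB : ∀ i j, 0 ≤ B i j) {x y : n → ℝ} (h : x ≤ y) :
    B.mulVec x ≤ B.mulVec y := fun i =>
  Finset.sum_le_sum fun j _ => mul_le_mul_of_nonneg_left (h j) (hB i j)

omit [DecidableEq n] in
lemma mulVec_nonneg {B : Matrix n n ℝ} (hB : ∀ i j, 0 ≤ B i j) {x : n → ℝ} (hx : 0 ≤ x) :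
    0 ≤ B.mulVec x := fun i =>
  Finset.sum_nonneg fun j _ => mul_nonneg (hB i j) (hx j)

lemma pow_nonneg_apply {B : Matrix n n ℝ} (hB : ∀ i j, 0 ≤ B i j) (k : ℕ) :
    ∀ i j, 0 ≤ (B ^ k) i j := by
  induction k with
  | zero => intro i j; rw [pow_zero, Matrix.one_apply]; split_ifs <;> norm_num
  | succ k ih =>
    intro i j
    rw [pow_succ, Matrix.mul_apply]
    exact Finset.sum_nonneg fun l _ => mul_nonneg (ih i l) (hB l j)

/-- A nonzero nonnegative subinvariant vector bounds the spectral radius from below. -/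
lemma le_rho_of_smul_le_mulVec {B : Matrix n n ℝ} (hB : ∀ i j, 0 ≤ B i j) {x : n → ℝ}
    (hx : 0 ≤ x) (hx0 : x ≠ 0) {a : ℝ} (ha : 0 ≤ a) (h : a • x ≤ B.mulVec x) : a ≤ rho B := by
  by_contra! hlt
  obtain ⟨r, hr1, hr2⟩ := exists_between hlt
  have hr0 : 0 < r := (rho_nonneg B).trans_lt hr1
  obtain ⟨C, hC, hb⟩ := exists_abs_pow_apply_le B hr1
  obtain ⟨i, hi⟩ : ∃ i, x i ≠ 0 := Function.ne_iff.1 hx0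
  have hi : 0 < x i := lt_of_le_of_ne (hx i) (Ne.symm hi)
  -- Iterating the inequality makes B^k grow at least like a^k on x, which beats the Gelfand bound C
  -- r^k since r < a.
  have hpow : ∀ k, (a ^ k) • x ≤ (B ^ k).mulVec x := by
    intro k
    induction k with
    | zero => simp
    | succ k ih =>
      calc (a ^ (k + 1)) • x = a ^ k • (a • x) := by rw [smul_smul, pow_succ]
        _ ≤ a ^ k • B.mulVec x := smul_le_smul_of_nonneg_left h (by positivity)
        _ = B.mulVec (a ^ k • x) := by rw [Matrix.mulVec_smul]
        _ ≤ B.mulVec ((B ^ k).mulVec x) := mulVec_mono hB ih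
        _ = (B ^ (k + 1)).mulVec x := by rw [Matrix.mulVec_mulVec, pow_succ']
  have hle : ∀ k : ℕ, (a / r) ^ k ≤ C * (∑ j, x j) / x i := by
    intro k
    rw [le_div_iff₀ hi, div_pow, div_mul_eq_mul_div, div_le_iff₀ (by positivity)]
    calc a ^ k * x i ≤ (B ^ k).mulVec x i := hpow k i
      _ ≤ ∑ j, (C * r ^ k) * x j := Finset.sum_le_sum fun j _ =>
          mul_le_mul_of_nonneg_right ((le_abs_self _).trans (hb k i j)) (hx j)
      _ = C * (∑ j, x j) * r ^ k := by rw [← Finset.mul_sum]; ring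
  have := tendsto_pow_atTop_atTop_of_one_lt ((one_lt_div hr0).2 hr2)
  obtain ⟨k, hk⟩ := (this.eventually_gt_atTop (C * (∑ j, x j) / x i)).exists
  exact absurd (hle k) (not_le.2 hk)

/-- A positive superinvariant vector bounds the spectral radius from above. -/
lemma rho_le_of_mulVec_le_smul {B : Matrix n n ℝ} (hB : ∀ i j, 0 ≤ B i j) {x : n → ℝ}
    (hx : ∀ i, 0 < x i) {a : ℝ} (ha : 0 ≤ a) (h : B.mulVec x ≤ a • x) : rho B ≤ a := by
  cases isEmpty_or_nonempty n
  · rwa [rho_of_isEmpty]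
  obtain ⟨ζ, hζ, z, hz, he⟩ := exists_mulVec_eq_smul B
  rw [← hζ]
  -- An eigenvector of maximal modulus is measured in the sup norm weighted by x; the eigenvalue
  -- equation is read off at the coordinate where this norm is attained.
  obtain ⟨i, hi⟩ := Finite.exists_max fun i => ‖z i‖ / x i
  have hmax : ∀ j, ‖z j‖ ≤ ‖z i‖ / x i * x j := fun j => (div_le_iff₀ (hx j)).1 (hi j)
  have hzi : 0 < ‖z i‖ := by
    obtain ⟨j, hj⟩ : ∃ j, z j ≠ 0 := Function.ne_iff.1 hz
    have h1 : 0 < ‖z j‖ := norm_pos_iff.2 hj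
    have h2 := h1.trans_le (hmax j)
    rcases (norm_nonneg (z i)).eq_or_lt with h0 | h0
    · rw [← h0] at h2; simp at h2
    · exact h0
  have h1 : ‖ζ‖ * ‖z i‖ ≤ a * ‖z i‖ := by
    have h2 : (Matrix.mulVec (B.map (algebraMap ℝ ℂ)) z) i = ζ * z i := by rw [he]; rfl
    rw [← norm_mul, ← h2]
    calc ‖(Matrix.mulVec (B.map (algebraMap ℝ ℂ)) z) i‖
        ≤ ∑ j, ‖(B.map (algebraMap ℝ ℂ)) i j * z j‖ := norm_sum_le _ _
      _ ≤ ∑ j, ‖z i‖ / x i * (B i j * x j) := by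
          refine Finset.sum_le_sum fun j _ => ?_
          rw [norm_mul]
          have : ‖(B.map (algebraMap ℝ ℂ)) i j‖ = B i j := by simp [abs_of_nonneg (hB i j)]
          rw [this]
          calc B i j * ‖z j‖ ≤ B i j * (‖z i‖ / x i * x j) :=
                mul_le_mul_of_nonneg_left (hmax j) (hB i j)
            _ = _ := by ring
      _ = ‖z i‖ / x i * (B.mulVec x i) := by rw [← Finset.mul_sum]; rfl
      _ ≤ ‖z i‖ / x i * (a * x i) :=
          mul_le_mul_of_nonneg_left (h i) (div_nonneg hzi.le (hx i).le)
      _ = a * ‖z i‖ := by field_simp [(hx i).ne']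
  exact le_of_mul_le_mul_right h1 hzi

end SpectralRadius

end RemoteEstimation

/-! ### Minimal growth rate of the packet error matrices -/

namespace RemoteEstimation

namespace Channel

open Topology

variable {M Mbar : ℕ} (c : Channel M Mbar)

lemma E_mulVec_apply (v : Fin Mbar → Fin M) (y : Fin Mbar → ℝ) (i : Fin Mbar) :
    (c.E v).mulVec y i = ∑ j, (if c.isOn j (v i) then 0 else c.P i j) * y j := rfl

lemma E_nonneg (hP : ∀ i j, 0 ≤ c.P i j) (v : Fin Mbar → Fin M) (i j : Fin Mbar) :
    0 ≤ c.E v i j := by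
  simp only [E, Matrix.of_apply]
  split_ifs
  · exact le_rfl
  · exact hP i j

lemma list_prod_nonneg (l : List (Matrix (Fin Mbar) (Fin Mbar) ℝ))
    (hl : ∀ B ∈ l, ∀ i j, 0 ≤ B i j) : ∀ i j, 0 ≤ l.prod i j := by
  induction l with
  | nil => intro i j; rw [List.prod_nil, Matrix.one_apply]; split_ifs <;> norm_num
  | cons B l ih =>
    intro i j
    rw [List.prod_cons, Matrix.mul_apply]
    exact Finset.sum_nonneg fun k _ => mul_nonneg (hl B (by simp) i k)
      (ih (fun B' h => hl B' (by simp [h])) k j)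

/-- Because the vector x is common to all factors, the lower bound survives products of different
matrices; individual Perron vectors would not give this. -/
lemma pow_smul_le_list_prod_mulVec (l : List (Matrix (Fin Mbar) (Fin Mbar) ℝ)) {a : ℝ}
    {x : Fin Mbar → ℝ} (ha : 0 ≤ a) (hl : ∀ B ∈ l, (∀ i j, 0 ≤ B i j) ∧ a • x ≤ B.mulVec x) :
    a ^ l.length • x ≤ l.prod.mulVec x := by
  induction l with
  | nil => simp
  | cons B l ih =>
    have hB := hl B (by simp)
    rw [List.prod_cons, ← Matrix.mulVec_mulVec, List.length_cons, pow_succ, ← smul_smul]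
    calc a ^ l.length • a • x ≤ a ^ l.length • B.mulVec x :=
          smul_le_smul_of_nonneg_left hB.2 (by positivity)
      _ = B.mulVec (a ^ l.length • x) := by rw [Matrix.mulVec_smul]
      _ ≤ B.mulVec (l.prod.mulVec x) :=
        mulVec_mono hB.1 (ih fun B' h => hl B' (by simp [h]))

lemma pow_mulVec_le_smul {B : Matrix (Fin Mbar) (Fin Mbar) ℝ} (hB : ∀ i j, 0 ≤ B i j)
    {y : Fin Mbar → ℝ} {s : ℝ} (hs : 0 ≤ s) (h : B.mulVec y ≤ s • y) (k : ℕ) :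
    (B ^ k).mulVec y ≤ s ^ k • y := by
  induction k with
  | zero => simp
  | succ k ih =>
    calc (B ^ (k + 1)).mulVec y = B.mulVec ((B ^ k).mulVec y) := by
          rw [Matrix.mulVec_mulVec, pow_succ']
      _ ≤ B.mulVec (s ^ k • y) := mulVec_mono hB ih
      _ = s ^ k • B.mulVec y := by rw [Matrix.mulVec_smul]
      _ ≤ s ^ k • s • y := smul_le_smul_of_nonneg_left h (by positivity)
      _ = s ^ (k + 1) • y := by rw [smul_smul, pow_succ]

/-- The value at L = 0, where the exponent 1/L is 0 by convention, is invisible to the lower limit.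
-/
lemma lamInf_eq {a : ℝ} (h : ∀ L, 1 ≤ L → c.lam L = a) : c.lamInf = a := by
  refine (Tendsto.liminf_eq (tendsto_const_nhds.congr' ?_))
  filter_upwards [eventually_ge_atTop 1] with L hL
  exact (h L hL).symm

/-- Componentwise minimum of `E(v) y` over all channel selection vectors `v`. -/
def minE [NeZero M] (y : Fin Mbar → ℝ) (i : Fin Mbar) : ℝ :=
  Finset.univ.inf' Finset.univ_nonempty fun m => (c.E fun _ => m).mulVec y i

variable [NeZero M]

lemma minE_le (y : Fin Mbar → ℝ) (v : Fin Mbar → Fin M) : c.minE y ≤ (c.E v).mulVec y :=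
  fun i => Finset.inf'_le _ (Finset.mem_univ (v i))

/-- Row i of the matrix involves only the i-th entry of v, so the minimizing channels can be chosen
row by row and assembled into one v. -/
lemma exists_minE_eq (y : Fin Mbar → ℝ) : ∃ v, (c.E v).mulVec y = c.minE y := by
  have : ∀ i, ∃ m, (c.E fun _ => m).mulVec y i = c.minE y i := by
    intro i
    obtain ⟨m, -, hm⟩ := Finset.exists_mem_eq_inf' (s := (Finset.univ : Finset (Fin M)))
      Finset.univ_nonempty fun m => (c.E fun _ => m).mulVec y i
    exact ⟨m, hm.symm⟩
  choose v hv using this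
  exact ⟨v, funext fun i => hv i⟩

lemma minE_mono (hP : ∀ i j, 0 ≤ c.P i j) : Monotone c.minE := by
  intro x y h
  obtain ⟨v, hv⟩ := c.exists_minE_eq y
  rw [← hv]
  exact (c.minE_le x v).trans (mulVec_mono (c.E_nonneg hP v) h)

lemma minE_nonneg (hP : ∀ i j, 0 ≤ c.P i j) {y : Fin Mbar → ℝ} (hy : 0 ≤ y) : 0 ≤ c.minE y := by
  obtain ⟨v, hv⟩ := c.exists_minE_eq y
  rw [← hv]
  exact mulVec_nonneg (c.E_nonneg hP v) hy

lemma continuous_mulVec_apply (B : Matrix (Fin Mbar) (Fin Mbar) ℝ) (i : Fin Mbar) :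
    Continuous fun y : Fin Mbar → ℝ => B.mulVec y i := by
  unfold Matrix.mulVec dotProduct
  fun_prop

lemma continuous_minE (i : Fin Mbar) : Continuous fun y => c.minE y i :=
  Continuous.finset_inf'_apply _ fun _ _ => continuous_mulVec_apply _ i

omit [NeZero M] in
lemma ne_zero_of_mem_stdSimplex {x : Fin Mbar → ℝ} (hx : x ∈ stdSimplex ℝ (Fin Mbar)) :
    x ≠ 0 := by
  rintro rfl
  simpa using hx.2

/-- For each level `s`, either all packet error matrices admit a common subinvariant vector or one
of them admits a positive superinvariant vector. -/
lemma subinvariant_or_superinvariant (hP : ∀ i j, 0 ≤ c.P i j) {s : ℝ} (hs : 0 < s) :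
    (∃ x ∈ stdSimplex ℝ (Fin Mbar), ∀ v, s • x ≤ (c.E v).mulVec x) ∨
      ∃ v, ∃ y : Fin Mbar → ℝ, (∀ i, 1 ≤ y i) ∧ (c.E v).mulVec y ≤ s • y := by
  -- Value iteration from 0 for the fixed point equation y = 1 + s⁻¹ min E y. The iterates increase,
  -- so their total mass either diverges or converges, which is the dichotomy.
  set f : (Fin Mbar → ℝ) → Fin Mbar → ℝ := fun y => 1 + s⁻¹ • c.minE y with hf
  have hfmono : Monotone f := fun x y h =>
    add_le_add le_rfl (smul_le_smul_of_nonneg_left (c.minE_mono hP h) (by positivity))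
  set y : ℕ → Fin Mbar → ℝ := fun n => f^[n] 0 with hy
  have hsucc : ∀ n, y (n + 1) = f (y n) := fun n => Function.iterate_succ_apply' f n 0
  have hmono : Monotone y := by
    refine monotone_nat_of_le_succ fun n => ?_
    induction n with
    | zero =>
      rw [hsucc]
      have h0 : (0 : Fin Mbar → ℝ) ≤ s⁻¹ • c.minE 0 :=
        smul_nonneg (by positivity) (c.minE_nonneg hP le_rfl)
      exact (zero_le_one).trans (le_add_of_nonneg_right h0)
    | succ n ih =>
      rw [hsucc, hsucc (n + 1)]
      exact hfmono ih
  have hy0 : ∀ n, 0 ≤ y n := fun n => hmono (Nat.zero_le n)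
  have hS : Monotone fun n => ∑ i, y n i := fun m n h =>
    Finset.sum_le_sum fun i _ => hmono h i
  rcases tendsto_atTop_of_monotone hS with hS' | ⟨B, hB⟩
  · left
    -- The zeroth iterate has mass 0, so normalization starts only at n₀.
    have hpos : ∀ᶠ n in atTop, 0 < ∑ i, y n i := hS'.eventually_gt_atTop 0
    obtain ⟨n₀, hn₀⟩ := eventually_atTop.1 hpos
    set x : ℕ → Fin Mbar → ℝ := fun n => (∑ i, y (n + n₀) i)⁻¹ • y (n + n₀) with hx
    have hxmem : ∀ n, x n ∈ stdSimplex ℝ (Fin Mbar) := by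
      intro n
      have hp := hn₀ (n + n₀) (by omega)
      refine ⟨fun i => mul_nonneg (by positivity) (hy0 _ i), ?_⟩
      simp only [hx, Pi.smul_apply, smul_eq_mul, ← Finset.mul_sum]
      exact inv_mul_cancel₀ hp.ne'
    obtain ⟨z, hz, φ, hφ, hlim⟩ := (isCompact_stdSimplex ℝ (Fin Mbar)).tendsto_subseq hxmem
    refine ⟨z, hz, fun v i => ?_⟩
    -- Divide y_n ≤ y_(n+1) ≤ 1 + s⁻¹ E(v) y_n by the mass of y_n. The constant term vanishes in the
    -- limit, and a limit point in the simplex is subinvariant for every v.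
    have hineq : ∀ n, x n i ≤ (∑ i, y (n + n₀) i)⁻¹ + s⁻¹ * (c.E v).mulVec (x n) i := by
      intro n
      have hp := hn₀ (n + n₀) (by omega)
      have h1 : y (n + n₀) i ≤ 1 + s⁻¹ * (c.E v).mulVec (y (n + n₀)) i := by
        refine (hmono (Nat.le_succ _) i).trans ?_
        rw [Nat.succ_eq_add_one, hsucc]
        simp only [hf, Pi.add_apply, Pi.one_apply, Pi.smul_apply, smul_eq_mul]
        gcongr
        exact c.minE_le _ v i
      calc x n i = (∑ i, y (n + n₀) i)⁻¹ * y (n + n₀) i := rfl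
        _ ≤ (∑ i, y (n + n₀) i)⁻¹ * (1 + s⁻¹ * (c.E v).mulVec (y (n + n₀)) i) := by gcongr
        _ = _ := by
          simp only [hx, Matrix.mulVec_smul, Pi.smul_apply, smul_eq_mul]
          ring
    have hl1 : Tendsto (fun n => x (φ n) i) atTop (𝓝 (z i)) :=
      ((continuous_apply i).tendsto z).comp hlim
    have hl2 : Tendsto (fun n => (∑ i, y (φ n + n₀) i)⁻¹) atTop (𝓝 0) :=
      tendsto_inv_atTop_zero.comp
        (hS'.comp ((tendsto_add_atTop_nat n₀).comp hφ.tendsto_atTop))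
    have hl3 : Tendsto (fun n => (c.E v).mulVec (x (φ n)) i) atTop (𝓝 ((c.E v).mulVec z i)) :=
      ((continuous_mulVec_apply (c.E v) i).tendsto z).comp hlim
    have hle := le_of_tendsto_of_tendsto' hl1 (hl2.add (hl3.const_mul s⁻¹)) fun n => hineq (φ n)
    rw [zero_add, inv_mul_eq_div, le_div_iff₀ hs] at hle
    simpa [mul_comm] using hle
  · right
    have hbd : ∀ n i, y n i ≤ B := fun n i =>
      (Finset.single_le_sum (f := fun i => y n i) (fun i _ => hy0 n i) (Finset.mem_univ i)).trans
        (hS.ge_of_tendsto hB n)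
    set z : Fin Mbar → ℝ := fun i => ⨆ n, y n i with hz
    have hlim : Tendsto y atTop (𝓝 z) := by
      refine tendsto_pi_nhds.2 fun i => tendsto_atTop_ciSup (fun m n h => hmono h i) ?_
      exact ⟨B, by rintro _ ⟨n, rfl⟩; exact hbd n i⟩
    -- By continuity the bounded limit solves z = 1 + s⁻¹ min E z; hence z ≥ 1 and min E z = s (z -
    -- 1) ≤ s z.
    have hfix : ∀ i, z i = 1 + s⁻¹ * c.minE z i := by
      intro i
      have h1 : Tendsto (fun n => y (n + 1) i) atTop (𝓝 (z i)) :=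
        ((continuous_apply i).tendsto z).comp (hlim.comp (tendsto_add_atTop_nat 1))
      have h2 : Tendsto (fun n => 1 + s⁻¹ * c.minE (y n) i) atTop (𝓝 (1 + s⁻¹ * c.minE z i)) :=
        ((((c.continuous_minE i).tendsto z).comp hlim).const_mul s⁻¹).const_add 1
      refine tendsto_nhds_unique h1 (h2.congr fun n => ?_)
      rw [hsucc]
      rfl
    have hz0 : 0 ≤ z := fun i => ge_of_tendsto' (((continuous_apply i).tendsto z).comp hlim)
      fun n => hy0 n i
    have hT0 := c.minE_nonneg hP hz0
    obtain ⟨v, hv⟩ := c.exists_minE_eq z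
    refine ⟨v, z, fun i => ?_, fun i => ?_⟩
    · rw [hfix i]
      exact le_add_of_nonneg_right (mul_nonneg (by positivity) (hT0 i))
    · rw [hv, Pi.smul_apply, smul_eq_mul]
      conv_rhs => rw [hfix i]
      rw [mul_add, mul_inv_cancel_left₀ hs.ne']
      linarith

/-- The minimal growth rate of the packet error matrices, with a common subinvariant vector at
this rate and superinvariant vectors at all larger rates. -/
lemma exists_growth_rate [Nonempty (Fin Mbar)] (hP : ∀ i j, 0 ≤ c.P i j) :
    ∃ a : ℝ, 0 ≤ a ∧
      (∃ x ∈ stdSimplex ℝ (Fin Mbar), ∀ v, a • x ≤ (c.E v).mulVec x) ∧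
      ∀ s, a < s → ∃ v, ∃ y : Fin Mbar → ℝ, (∀ i, 1 ≤ y i) ∧ (c.E v).mulVec y ≤ s • y := by
  set R := rho (c.E fun _ => 0) with hR
  -- The rate a is the largest first coordinate in this compact set. Truncation at R loses nothing,
  -- since a subinvariant rate cannot exceed the spectral radius of any single E(v).
  set K : Set (ℝ × (Fin Mbar → ℝ)) :=
    (Set.Icc 0 R ×ˢ stdSimplex ℝ (Fin Mbar)) ∩
      {q | ∀ v, q.1 • q.2 ≤ (c.E v).mulVec q.2} with hK
  have hclosed : IsClosed {q : ℝ × (Fin Mbar → ℝ) | ∀ v, q.1 • q.2 ≤ (c.E v).mulVec q.2} := by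
    simp only [Set.ofPred_forall, Pi.le_def]
    refine isClosed_iInter fun v => isClosed_iInter fun i => isClosed_le ?_ ?_
    · simp only [Pi.smul_apply, smul_eq_mul]
      fun_prop
    · exact (continuous_mulVec_apply (c.E v) i).comp continuous_snd
  have hKc : IsCompact K := (isCompact_Icc.prod (isCompact_stdSimplex ℝ (Fin Mbar))).inter_right hclosed
  have hmemK : ∀ s, 0 ≤ s → ∀ x ∈ stdSimplex ℝ (Fin Mbar), (∀ v, s • x ≤ (c.E v).mulVec x) →
      (s, x) ∈ K := fun s hs x hx h => ⟨⟨⟨hs, le_rho_of_smul_le_mulVec (c.E_nonneg hP _)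
        hx.1 (ne_zero_of_mem_stdSimplex hx) hs (h _)⟩, hx⟩, h⟩
  have hKne : K.Nonempty := by
    obtain ⟨i⟩ := ‹Nonempty (Fin Mbar)›
    refine ⟨(0, Pi.single i 1), hmemK 0 le_rfl _ (single_mem_stdSimplex ℝ i) fun v => ?_⟩
    rw [zero_smul]
    exact mulVec_nonneg (c.E_nonneg hP v) (single_mem_stdSimplex ℝ i).1
  obtain ⟨⟨a, x⟩, hax, hmax⟩ := hKc.exists_isMaxOn hKne continuous_fst.continuousOn
  have ha0 : 0 ≤ a := hax.1.1.1
  refine ⟨a, ha0, ⟨x, hax.1.2, hax.2⟩, fun s hs => ?_⟩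
  rcases c.subinvariant_or_superinvariant hP (ha0.trans_lt hs) with ⟨x', hx', h⟩ | h
  · have : s ≤ a := hmax (hmemK s (ha0.trans hs.le) x' hx' h)
    exact absurd hs (not_lt.2 this)
  · exact h

/-- All `λ_L`, `L ≥ 1`, agree with the minimal growth rate. -/
lemma lam_eq_of_growth_rate (hP : ∀ i j, 0 ≤ c.P i j) {a : ℝ} (ha : 0 ≤ a)
    {x : Fin Mbar → ℝ} (hx : x ∈ stdSimplex ℝ (Fin Mbar)) (hax : ∀ v, a • x ≤ (c.E v).mulVec x)
    (hsup : ∀ s, a < s → ∃ v, ∃ y : Fin Mbar → ℝ, (∀ i, 1 ≤ y i) ∧ (c.E v).mulVec y ≤ s • y)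
    {L : ℕ} (hL : 1 ≤ L) : c.lam L = a := by
  have hL0 : (L : ℝ) ≠ 0 := by norm_cast; omega
  have hroot : ∀ s : ℝ, 0 ≤ s → (s ^ L) ^ (1 / (L : ℝ)) = s := by
    intro s hs
    rw [← Real.rpow_natCast, ← Real.rpow_mul hs, mul_one_div_cancel hL0, Real.rpow_one]
  apply le_antisymm
  · refine le_of_forall_gt_imp_ge_of_dense fun s hs => ?_
    have hs0 : 0 ≤ s := ha.trans hs.le
    -- Repeating the same v in all L factors already achieves every rate above a.
    obtain ⟨v, y, hy, hle⟩ := hsup s hs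
    refine (ciInf_le (Set.finite_range _).bddBelow fun _ => v).trans ?_
    rw [List.ofFn_const, List.prod_replicate]
    conv_rhs => rw [← hroot s hs0]
    refine Real.rpow_le_rpow (rho_nonneg _) ?_ (by positivity)
    exact rho_le_of_mulVec_le_smul (pow_nonneg_apply (c.E_nonneg hP v) L)
      (fun i => zero_lt_one.trans_le (hy i)) (by positivity)
      (pow_mulVec_le_smul (c.E_nonneg hP v) hs0 hle L)
  · refine le_ciInf fun v => ?_
    conv_lhs => rw [← hroot a ha]
    refine Real.rpow_le_rpow (by positivity) ?_ (by positivity)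
    have hmem : ∀ B ∈ List.ofFn fun k => c.E (v k), ∃ k, B = c.E (v k) := by
      intro B hB
      obtain ⟨k, hk⟩ := (List.mem_ofFn' _ _).1 hB
      exact ⟨k, hk.symm⟩
    refine le_rho_of_smul_le_mulVec (list_prod_nonneg _ fun B hB => ?_) hx.1
      (ne_zero_of_mem_stdSimplex hx) (by positivity) ?_
    · obtain ⟨k, rfl⟩ := hmem B hB
      exact c.E_nonneg hP _
    · have := pow_smul_le_list_prod_mulVec (List.ofFn fun k => c.E (v k)) (x := x) ha fun B hB => by
        obtain ⟨k, rfl⟩ := hmem B hB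
        exact ⟨c.E_nonneg hP _, hax _⟩
      rwa [List.length_ofFn] at this

end Channel

end RemoteEstimation

/-! ### Quadratic forms along complex eigenvectors -/

namespace RemoteEstimation

section QuadraticForm

variable {n : Type*} [Fintype n] [DecidableEq n]

open Matrix

omit [DecidableEq n] in
lemma dotProduct_mulVec_conj (A B : Matrix n n ℝ) (x y : n → ℝ) :
    x ⬝ᵥ (A * B * Aᵀ) *ᵥ y = (Aᵀ *ᵥ x) ⬝ᵥ B *ᵥ (Aᵀ *ᵥ y) := by
  rw [← mulVec_mulVec, ← mulVec_mulVec, dotProduct_mulVec x A, mulVec_transpose A x]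

/-- Factor B as DᵀD and apply Cauchy–Schwarz to each row of D. -/
lemma _root_.Matrix.PosSemidef.dotProduct_mulVec_le_trace {B : Matrix n n ℝ} (hB : B.PosSemidef)
    (x : n → ℝ) : x ⬝ᵥ B *ᵥ x ≤ (∑ i, x i ^ 2) * B.trace := by
  obtain ⟨D, rfl⟩ : ∃ D : Matrix n n ℝ, B = Dᵀ * D := by
    open scoped MatrixOrder in
    obtain ⟨D, hD⟩ := CStarAlgebra.nonneg_iff_eq_star_mul_self.mp hB.nonneg
    exact ⟨D, by simpa [star_eq_conjTranspose] using hD⟩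
  have h1 : x ⬝ᵥ (Dᵀ * D) *ᵥ x = ∑ i, (∑ j, D i j * x j) ^ 2 := by
    rw [← mulVec_mulVec, dotProduct_mulVec, vecMul_transpose]
    simp [dotProduct, mulVec, sq]
  have h2 : (Dᵀ * D).trace = ∑ i, ∑ j, D i j ^ 2 := by
    rw [Finset.sum_comm]
    simp [trace, mul_apply, sq]
  rw [h1, h2, Finset.mul_sum]
  refine Finset.sum_le_sum fun i _ => ?_
  rw [mul_comm]
  exact Finset.sum_mul_sq_le_sq_mul_sq _ _ _

/-- A left eigenvector of maximal modulus, split into its real and imaginary parts. -/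
lemma exists_real_imag_eigenvector [Nonempty n] (A : Matrix n n ℝ) :
    ∃ (α β : ℝ) (a b : n → ℝ), α ^ 2 + β ^ 2 = rho A ^ 2 ∧ (a ≠ 0 ∨ b ≠ 0) ∧
      Aᵀ *ᵥ a = α • a - β • b ∧ Aᵀ *ᵥ b = β • a + α • b := by
  obtain ⟨ζ, hζ, z, hz, h⟩ := exists_vecMul_eq_smul A
  refine ⟨ζ.re, ζ.im, fun i => (z i).re, fun i => (z i).im, ?_, ?_, ?_, ?_⟩
  · rw [← hζ, Complex.sq_norm, Complex.normSq_apply]; ring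
  · by_contra! hcon
    exact hz (funext fun i => Complex.ext (congrFun hcon.1 i) (congrFun hcon.2 i))
  · ext i
    have := congrArg Complex.re (congrFun h i)
    simpa [vecMul, mulVec, dotProduct, mul_comm] using this
  · ext i
    have := congrArg Complex.im (congrFun h i)
    simpa [vecMul, mulVec, dotProduct, mul_comm, add_comm] using this

/-- The two real relations say that a + ib is a left eigenvector of A for α + iβ. -/
lemma le_rho_of_real_imag_eigenvector (A : Matrix n n ℝ) {α β : ℝ} {a b : n → ℝ}
    (hab : a ≠ 0 ∨ b ≠ 0) (ha : Aᵀ *ᵥ a = α • a - β • b) (hb : Aᵀ *ᵥ b = β • a + α • b) :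
    α ^ 2 + β ^ 2 ≤ rho A ^ 2 := by
  have hz : (fun i => (⟨a i, b i⟩ : ℂ)) ≠ 0 := by
    intro h
    rcases hab with h' | h'
    · exact h' (funext fun i => congrArg Complex.re (congrFun h i))
    · exact h' (funext fun i => congrArg Complex.im (congrFun h i))
  have h := norm_eigenvalue_le_rho A (ζ := ⟨α, β⟩) hz (by
    ext i
    apply Complex.ext
    · have := congrFun ha i
      simpa [vecMul, mulVec, dotProduct, mul_comm] using this
    · have := congrFun hb i
      simpa [vecMul, mulVec, dotProduct, mul_comm, add_comm] using this)
  have h2 : ‖(⟨α, β⟩ : ℂ)‖ ^ 2 = α ^ 2 + β ^ 2 := by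
    rw [Complex.sq_norm, Complex.normSq_apply]; ring
  rw [← h2]
  exact pow_le_pow_left₀ (norm_nonneg _) h 2

/-- Sum of the values of a bilinear form at two vectors: for the real and imaginary parts of a
complex vector `u` this is `Re (u* B u)`. -/
def pairForm (a b : n → ℝ) (B : Matrix n n ℝ) : ℝ := a ⬝ᵥ B *ᵥ a + b ⬝ᵥ B *ᵥ b

omit [DecidableEq n] in
lemma pairForm_sub (a b : n → ℝ) (B D : Matrix n n ℝ) :
    pairForm a b (B - D) = pairForm a b B - pairForm a b D := by
  simp only [pairForm, sub_mulVec, dotProduct_sub]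
  ring

omit [DecidableEq n] in
-- On the pair (a, b) the transpose of A acts as a rotation scaled by the modulus of the eigenvalue;
-- the cross terms of the two quadratic forms cancel even without symmetry of B.
lemma pairForm_conj {A : Matrix n n ℝ} {α β : ℝ} {a b : n → ℝ}
    (ha : Aᵀ *ᵥ a = α • a - β • b) (hb : Aᵀ *ᵥ b = β • a + α • b) (B : Matrix n n ℝ) :
    pairForm a b (A * B * Aᵀ) = (α ^ 2 + β ^ 2) * pairForm a b B := by
  simp only [pairForm, dotProduct_mulVec_conj, ha, hb, mulVec_sub, mulVec_add, mulVec_smul,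
    dotProduct_sub, sub_dotProduct, dotProduct_add, add_dotProduct, smul_dotProduct,
    dotProduct_smul, smul_eq_mul]
  ring

lemma pairForm_pow_conj {A : Matrix n n ℝ} {α β : ℝ} {a b : n → ℝ}
    (ha : Aᵀ *ᵥ a = α • a - β • b) (hb : Aᵀ *ᵥ b = β • a + α • b) (B : Matrix n n ℝ) (k : ℕ) :
    pairForm a b (A ^ k * B * (A ^ k)ᵀ) = (α ^ 2 + β ^ 2) ^ k * pairForm a b B := by
  induction k with
  | zero => simp
  | succ k ih =>
    have : A ^ (k + 1) * B * (A ^ (k + 1))ᵀ = A * (A ^ k * B * (A ^ k)ᵀ) * Aᵀ := by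
      rw [pow_succ', transpose_mul]
      simp only [Matrix.mul_assoc]
    rw [this, pairForm_conj ha hb, ih, pow_succ']
    ring

end QuadraticForm

/-! ### Growth of the error covariance with the age -/

namespace LTIProcess

open Matrix

variable (p : LTIProcess)

/-- Covariance of the remote estimation error at age of information `k`. -/
def errCov (k : ℕ) : Matrix (Fin p.l) (Fin p.l) ℝ := p.priorCov^[k] p.Pbar

lemma errCov_succ (k : ℕ) : p.errCov (k + 1) = p.A * p.errCov k * p.Aᵀ + p.W :=
  Function.iterate_succ_apply' p.priorCov k p.Pbar

/-- The noise covariance cancels in differences, so each increment is a conjugate of the first one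
and sums of increments behave like geometric series. -/
lemma errCov_succ_sub (k : ℕ) :
    p.errCov (k + 1) - p.errCov k = p.A ^ k * (p.priorCov p.Pbar - p.Pbar) * (p.A ^ k)ᵀ := by
  induction k with
  | zero => simp [errCov]
  | succ k ih =>
    rw [errCov_succ, p.errCov_succ k, add_sub_add_right_eq_sub, ← Matrix.sub_mul, ← Matrix.mul_sub,
      ← p.errCov_succ k, ih, pow_succ', transpose_mul]
    simp only [Matrix.mul_assoc]

namespace IsSteadyStable

variable {p} (hp : p.IsSteadyStable)
include hp

lemma posSemidef_priorCov {B : Matrix (Fin p.l) (Fin p.l) ℝ} (hB : B.PosSemidef) :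
    (p.priorCov B).PosSemidef := by
  have := hB.mul_mul_conjTranspose_same p.A
  rw [conjTranspose_eq_transpose_of_trivial] at this
  exact this.add hp.posSemidef_W

lemma posSemidef_errCov (k : ℕ) : (p.errCov k).PosSemidef := by
  induction k with
  | zero => exact hp.posSemidef_Pbar
  | succ k ih => rw [p.errCov_succ]; exact hp.posSemidef_priorCov ih

lemma posDef_innovationCov : (p.innovationCov p.Pbar).PosDef := by
  have h := (hp.posSemidef_priorCov hp.posSemidef_Pbar).mul_mul_conjTranspose_same p.C
  rw [conjTranspose_eq_transpose_of_trivial] at h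
  have h2 : (p.innovationCov p.Pbar).PosSemidef := h.add hp.posSemidef_V
  exact (h2.posDef_iff_isUnit).2 hp.isUnit_innovation

lemma transpose_priorCov : (p.priorCov p.Pbar)ᵀ = p.priorCov p.Pbar := by
  have := (hp.posSemidef_priorCov hp.posSemidef_Pbar).isHermitian
  rwa [IsHermitian, conjTranspose_eq_transpose_of_trivial] at this

lemma gain_mul_innovationCov :
    p.gain p.Pbar * p.innovationCov p.Pbar = p.priorCov p.Pbar * p.Cᵀ := by
  rw [gain, Matrix.mul_assoc, nonsing_inv_mul _ ((isUnit_iff_isUnit_det _).1 hp.isUnit_innovation),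
    Matrix.mul_one]

/-- The fixed point equation makes the first increment equal to K C S. In this symmetric form it is
visibly positive semidefinite, and its quadratic form vanishes exactly where C S does. -/
lemma priorCov_sub :
    p.priorCov p.Pbar - p.Pbar = p.priorCov p.Pbar * p.Cᵀ * (p.innovationCov p.Pbar)⁻¹ *
      (p.priorCov p.Pbar * p.Cᵀ)ᵀ := by
  have h := hp.fixed
  rw [posteriorCov, Matrix.sub_mul, Matrix.one_mul] at h

  rw [sub_eq_iff_eq_add, transpose_mul, hp.transpose_priorCov, transpose_transpose]
  rw [sub_eq_iff_eq_add, gain] at h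
  rw [add_comm, ← Matrix.mul_assoc]
  exact h

/-- Joseph form of the fixed point equation of the filter. -/
lemma joseph :
    (1 - p.gain p.Pbar * p.C) * p.priorCov p.Pbar * (1 - p.gain p.Pbar * p.C)ᵀ +
      p.gain p.Pbar * p.V * (p.gain p.Pbar)ᵀ = p.Pbar := by
  set K := p.gain p.Pbar with hK
  set S := p.priorCov p.Pbar with hS
  -- The gain equation rearranged; it turns the cross term of the Joseph form into the measurement
  -- noise term.
  have h1 : (1 - K * p.C) * S * p.Cᵀ = K * p.V := by
    have h2 := hp.gain_mul_innovationCov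
    rw [← hK, innovationCov, ← hS, Matrix.mul_add] at h2
    rw [Matrix.sub_mul, Matrix.one_mul, Matrix.sub_mul, ← h2]
    simp only [Matrix.mul_assoc]
    abel
  have h3 : (1 - K * p.C) * S = p.Pbar := hp.fixed
  calc _ = (1 - K * p.C) * S - (1 - K * p.C) * S * p.Cᵀ * Kᵀ + K * p.V * Kᵀ := by
        rw [transpose_sub, transpose_mul, Matrix.mul_sub, transpose_one, Matrix.mul_one,
          Matrix.mul_assoc _ p.Cᵀ Kᵀ]
    _ = p.Pbar := by rw [h1, h3]; abel

/-- Growth of the remote error covariance in the age of information, from below. -/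
lemma exists_le_trace_errCov (hA : 1 ≤ rho p.A) :
    ∃ c : ℝ, 0 < c ∧ ∀ k, c * ∑ j ∈ Finset.range k, (rho p.A ^ 2) ^ j ≤ (p.errCov k).trace := by
  cases isEmpty_or_nonempty (Fin p.l)
  · rw [rho_of_isEmpty] at hA
    norm_num at hA
  obtain ⟨α, β, a, b, hr, hab, ha, hb⟩ := exists_real_imag_eigenvector p.A
  set S := p.priorCov p.Pbar with hS
  set D := S - p.Pbar with hD
  have hDform : ∀ x, x ⬝ᵥ D *ᵥ x =
      ((S * p.Cᵀ)ᵀ *ᵥ x) ⬝ᵥ (p.innovationCov p.Pbar)⁻¹ *ᵥ ((S * p.Cᵀ)ᵀ *ᵥ x) := by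
    intro x
    rw [hD, hp.priorCov_sub, ← mulVec_mulVec, ← mulVec_mulVec, dotProduct_mulVec x (S * p.Cᵀ),
      mulVec_transpose (S * p.Cᵀ) x]
  have hinv := hp.posDef_innovationCov.inv
  have hnn : ∀ x, 0 ≤ x ⬝ᵥ D *ᵥ x := by
    intro x
    rw [hDform]
    simpa using hinv.posSemidef.dotProduct_mulVec_nonneg ((S * p.Cᵀ)ᵀ *ᵥ x)
  -- Where the increment vanishes the gain vanishes too, so the filter dynamics and A act alike on x
  -- from the left.
  have hzero : ∀ x, x ⬝ᵥ D *ᵥ x = 0 → ((1 - p.gain p.Pbar * p.C) * p.A)ᵀ *ᵥ x = p.Aᵀ *ᵥ x := by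
    intro x hx
    have h0 : (S * p.Cᵀ)ᵀ *ᵥ x = 0 := by
      by_contra hne
      have := hinv.dotProduct_mulVec_pos hne
      rw [hDform] at hx
      rw [star_trivial, hx] at this
      exact lt_irrefl _ this
    have hK : (p.gain p.Pbar)ᵀ *ᵥ x = 0 := by
      rw [gain, ← hS, transpose_mul, ← mulVec_mulVec, h0, mulVec_zero]
    rw [transpose_mul, transpose_sub, transpose_one, transpose_mul, ← mulVec_mulVec, sub_mulVec,
      ← mulVec_mulVec, hK]
    simp
  -- If the increment vanished on both parts of the eigenvector, an eigenvalue of A of modulus at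
  -- least 1 would be an eigenvalue of the stable filter dynamics.
  have hd : 0 < pairForm a b D := by
    refine lt_of_le_of_ne (add_nonneg (hnn a) (hnn b)) fun h0 => ?_
    have ha0 : a ⬝ᵥ D *ᵥ a = 0 := by
      have := hnn a; have := hnn b; simp only [pairForm] at h0; linarith
    have hb0 : b ⬝ᵥ D *ᵥ b = 0 := by
      have := hnn a; have := hnn b; simp only [pairForm] at h0; linarith
    have := le_rho_of_real_imag_eigenvector _ hab ((hzero a ha0).trans ha) ((hzero b hb0).trans hb)
    rw [hr] at this
    have hst := hp.stable
    have h1 := rho_nonneg ((1 - p.gain p.Pbar * p.C) * p.A)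
    nlinarith
  have hform : ∀ k, pairForm a b D * ∑ j ∈ Finset.range k, (rho p.A ^ 2) ^ j ≤
      pairForm a b (p.errCov k) := by
    intro k
    induction k with
    | zero =>
      have := (hp.posSemidef_errCov 0).dotProduct_mulVec_nonneg a
      have := (hp.posSemidef_errCov 0).dotProduct_mulVec_nonneg b
      simp only [star_trivial] at *
      simp only [pairForm, Finset.range_zero, Finset.sum_empty, mul_zero]
      linarith
    | succ k ih =>
      have h1 := pairForm_sub a b (p.errCov (k + 1)) (p.errCov k)
      rw [p.errCov_succ_sub, pairForm_pow_conj ha hb, hr] at h1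
      rw [Finset.sum_range_succ, mul_add]
      linarith
  set m := (∑ i, a i ^ 2) + ∑ i, b i ^ 2 with hm
  have hm0 : 0 ≤ m := by positivity
  have hle : ∀ k, pairForm a b (p.errCov k) ≤ m * (p.errCov k).trace := by
    intro k
    rw [hm, add_mul]
    exact add_le_add ((hp.posSemidef_errCov k).dotProduct_mulVec_le_trace a)
      ((hp.posSemidef_errCov k).dotProduct_mulVec_le_trace b)
  -- Adding 1 makes the denominator positive without appeal to a or b being nonzero.
  refine ⟨pairForm a b D / (m + 1), by positivity, fun k => ?_⟩
  have htr := (hp.posSemidef_errCov k).trace_nonneg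
  rw [div_mul_eq_mul_div, div_le_iff₀ (by positivity)]
  have := hform k
  have := hle k
  nlinarith

/-- Growth of the remote error covariance in the age of information, from above. -/
lemma exists_trace_errCov_le {s : ℝ} (hs : rho p.A ^ 2 < s) :
    ∃ C : ℝ, 0 ≤ C ∧ ∀ k, (p.errCov k).trace ≤ C * (1 + ∑ j ∈ Finset.range k, s ^ j) := by
  have hs0 : 0 ≤ s := (sq_nonneg _).trans hs.le
  -- Rate √s, because each increment contains two factors A^k.
  obtain ⟨C, hC, hb⟩ := exists_abs_pow_apply_le p.A
    ((Real.lt_sqrt (rho_nonneg _)).2 hs)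
  set D := p.priorCov p.Pbar - p.Pbar with hD
  set G := ∑ _i : Fin p.l, ∑ n : Fin p.l, ∑ m : Fin p.l, C * |D m n| * C with hG
  have hG0 : 0 ≤ G := by positivity
  have hstep : ∀ k, (p.errCov (k + 1)).trace ≤ (p.errCov k).trace + G * s ^ k := by
    intro k
    have h1 : (p.errCov (k + 1)).trace - (p.errCov k).trace = _ :=
      (trace_sub _ _).symm.trans (congrArg trace (p.errCov_succ_sub k))
    have h2 : (p.A ^ k * D * (p.A ^ k)ᵀ).trace ≤ G * s ^ k := by
      simp only [trace, diag_apply, Matrix.mul_apply, transpose_apply, hG, Finset.sum_mul]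
      refine Finset.sum_le_sum fun i _ => Finset.sum_le_sum fun n _ => Finset.sum_le_sum fun m _ => ?_
      have h3 : s ^ k = √s ^ k * √s ^ k := by rw [← mul_pow, Real.mul_self_sqrt hs0]
      calc (p.A ^ k) i m * D m n * (p.A ^ k) i n
          ≤ |(p.A ^ k) i m * D m n * (p.A ^ k) i n| := le_abs_self _
        _ = |(p.A ^ k) i m| * |D m n| * |(p.A ^ k) i n| := by rw [abs_mul, abs_mul]
        _ ≤ (C * √s ^ k) * |D m n| * (C * √s ^ k) := by
            gcongr
            · exact hb k i m
            · exact hb k i n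
        _ = C * |D m n| * C * s ^ k := by rw [h3]; ring
    linarith
  have h0 : 0 ≤ (p.errCov 0).trace := (hp.posSemidef_errCov 0).trace_nonneg
  refine ⟨(p.errCov 0).trace + G, by positivity, fun k => ?_⟩
  induction k with
  | zero => simp [hG0]
  | succ k ih =>
    have h2 := hstep k
    have h3 : 0 ≤ (p.errCov 0).trace * s ^ k := by positivity
    rw [Finset.sum_range_succ]
    nlinarith

end IsSteadyStable

end LTIProcess

end RemoteEstimation

/-! ### Ages along channel paths and the Markov property -/

namespace RemoteEstimation

section Paths

variable {N M Mbar : ℕ} (c : Channel M Mbar) (π : Policy N M Mbar)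

open Classical in
/-- One step of the AoI recursion, from channel state `i` to channel state `j`. -/
def nextAoi (φ : Fin N → ℕ) (i j : Fin Mbar) : Fin N → ℕ := fun n =>
  if ∃ m, π φ i n = some m ∧ c.isOn j m = true then 1 else φ n + 1

lemma aoi_one (s : ℕ → Fin Mbar) (n : Fin N) : aoi c π s 1 n = 1 := by
  simp [aoi, received]

/-- The step starts at time 1 because nothing is scheduled in slot 0: the decision uses the state at
t, its outcome the state at t + 1. -/
lemma aoi_add_two (s : ℕ → Fin Mbar) (t : ℕ) :
    aoi c π s (t + 2) = nextAoi c π (aoi c π s (t + 1)) (s t) (s (t + 1)) := by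
  funext n
  classical exact if_congr Iff.rfl rfl rfl

lemma aoi_le (s : ℕ → Fin Mbar) (t : ℕ) (n : Fin N) : aoi c π s t n ≤ t := by
  induction t with
  | zero => exact le_rfl
  | succ t ih =>
    simp only [aoi]
    split_ifs <;> omega

lemma aoi_pos (s : ℕ → Fin Mbar) (t : ℕ) (n : Fin N) : 1 ≤ aoi c π s (t + 1) n := by
  simp only [aoi]
  split_ifs <;> omega

/-- The age at time t is determined by the states strictly before t. This adaptedness is what the
Markov property and the measurability arguments need. -/
lemma aoi_congr {s s' : ℕ → Fin Mbar} {t : ℕ} (h : ∀ k < t, s k = s' k) :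
    aoi c π s t = aoi c π s' t := by
  induction t with
  | zero => rfl
  | succ t ih =>
    cases t with
    | zero => funext n; rw [aoi_one, aoi_one]
    | succ t =>
      rw [aoi_add_two, aoi_add_two, ih fun k hk => h k (by omega), h t (by omega),
        h (t + 1) (by omega)]

end Paths

namespace Realization

variable {N M Mbar : ℕ} {p : Fin N → LTIProcess} {Ω : Type*}

section Extension

/-- Extension of a finite channel path to an infinite one. -/
def extendPath {t : ℕ} (s : Fin (t + 1) → Fin Mbar) (k : ℕ) : Fin Mbar :=
  if hk : k < t + 1 then s ⟨k, hk⟩ else s 0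

lemma extendPath_of_lt {t : ℕ} (s : Fin (t + 1) → Fin Mbar) {k : ℕ} (hk : k < t + 1) :
    extendPath s k = s ⟨k, hk⟩ := dif_pos hk

end Extension

/-- Such an F factors through the finite set of paths of length t + 1. Measurability with respect to
the channel σ-algebra itself is what later yields independence from the noises. -/
lemma measurable_of_path (R : Realization p Mbar Ω) {α : Type*} [MeasurableSpace α] (t : ℕ)
    {F : (ℕ → Fin Mbar) → α} (hF : ∀ s s' : ℕ → Fin Mbar, (∀ k < t + 1, s k = s' k) → F s = F s') :
    Measurable[R.sigma .channel] fun ω => F fun k => R.h k ω := by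
  have h1 : (fun ω => F fun k => R.h k ω) =
      (fun s : Fin (t + 1) → Fin Mbar => F (extendPath s)) ∘ fun ω k => R.h k ω := by
    funext ω
    exact hF _ _ fun k hk => (extendPath_of_lt (fun k : Fin (t + 1) => R.h k ω) hk).symm
  rw [h1]
  refine Measurable.comp (measurable_of_finite _) ?_
  refine @measurable_pi_lambda _ _ _ (R.sigma .channel) _ _ fun k => ?_
  exact (comap_measurable (R.h k)).mono (le_iSup (fun t => MeasurableSpace.comap (R.h t) _) (k : ℕ))
    le_rfl

variable [MeasurableSpace Ω] {R : Realization p Mbar Ω} {c : Channel M Mbar} {μ : Measure Ω}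

namespace IsModel

variable (hR : R.IsModel c μ)
include hR

lemma sigma_le (i : Source N) : R.sigma i ≤ ‹MeasurableSpace Ω› := by
  cases i with
  | channel => exact iSup_le fun t => (hR.measurable_h t).comap_le
  | initial n => exact sup_le (hR.measurable_x0 n).comap_le (hR.measurable_xs0 n).comap_le
  | processNoise n t => exact (hR.measurable_w n t).comap_le
  | measurementNoise n t => exact (hR.measurable_v n t).comap_le

/-- The Markov property for functions of the channel path. -/
lemma lintegral_path_succ (t : ℕ) {F : (ℕ → Fin Mbar) → Fin Mbar → ENNReal}
    (hF : ∀ s s' : ℕ → Fin Mbar, (∀ k < t + 1, s k = s' k) → F s = F s') :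
    ∫⁻ ω, F (fun k => R.h k ω) (R.h (t + 1) ω) ∂μ =
      ∫⁻ ω, ∑ j, ENNReal.ofReal (c.P (R.h t ω) j) * F (fun k => R.h k ω) j ∂μ := by
  set Z : Ω → Fin (t + 1) → Fin Mbar := fun ω k => R.h k ω with hZ
  have hZm : Measurable Z := measurable_pi_lambda _ fun k => hR.measurable_h k
  have hYm : Measurable fun ω => (Z ω, R.h (t + 1) ω) := hZm.prodMk (hR.measurable_h _)
  have hFZ : ∀ ω, F (fun k => R.h k ω) = F (extendPath (Z ω)) := fun ω =>
    hF _ _ fun k hk => (extendPath_of_lt (Z ω) hk).symm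
  have h1 : ∫⁻ ω, F (fun k => R.h k ω) (R.h (t + 1) ω) ∂μ =
      ∑ s, ∑ j, F (extendPath s) j * μ ((fun ω => (Z ω, R.h (t + 1) ω)) ⁻¹' {(s, j)}) := by
    simp only [hFZ]
    rw [← lintegral_map (f := fun y : (Fin (t + 1) → Fin Mbar) × Fin Mbar => F (extendPath y.1) y.2)
      (measurable_of_finite _) hYm, lintegral_fintype, Fintype.sum_prod_type]
    refine Finset.sum_congr rfl fun s _ => Finset.sum_congr rfl fun j _ => ?_
    rw [Measure.map_apply hYm (measurableSet_singleton _)]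
  have h2 : ∫⁻ ω, ∑ j, ENNReal.ofReal (c.P (R.h t ω) j) * F (fun k => R.h k ω) j ∂μ =
      ∑ s, (∑ j, ENNReal.ofReal (c.P (s (Fin.last t)) j) * F (extendPath s) j) *
        μ (Z ⁻¹' {s}) := by
    simp only [hFZ]
    refine (lintegral_map (f := fun s : Fin (t + 1) → Fin Mbar =>
      ∑ j, ENNReal.ofReal (c.P (s (Fin.last t)) j) * F (extendPath s) j)
      (measurable_of_finite _) hZm).symm.trans ?_
    rw [lintegral_fintype]
    refine Finset.sum_congr rfl fun s _ => ?_
    rw [Measure.map_apply hZm (measurableSet_singleton _)]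
  rw [h1, h2]
  refine Finset.sum_congr rfl fun s _ => ?_
  rw [Finset.sum_mul]
  refine Finset.sum_congr rfl fun j _ => ?_
  -- The Markov hypothesis speaks of infinite paths; this one follows s up to time t and then takes
  -- the value j.
  have hM := hR.markov (fun k => if k < t + 1 then extendPath s k else j) t
  have e1 : (fun ω => (Z ω, R.h (t + 1) ω)) ⁻¹' {(s, j)} =
      {ω | ∀ k ≤ t + 1, R.h k ω = if k < t + 1 then extendPath s k else j} := by
    ext ω
    simp only [Set.mem_preimage, Set.mem_singleton_iff, Prod.mk.injEq, Set.mem_ofPred_eq]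
    constructor
    · rintro ⟨rfl, rfl⟩ k hk
      split_ifs with h
      · exact (extendPath_of_lt (Z ω) h).symm
      · rw [show k = t + 1 by omega]
    · intro h
      refine ⟨funext fun k => ?_, by simpa using h (t + 1) le_rfl⟩
      have := h k (by omega)
      rw [if_pos k.2, extendPath_of_lt _ k.2] at this
      exact this
  have e2 : Z ⁻¹' {s} = {ω | ∀ k ≤ t, R.h k ω = if k < t + 1 then extendPath s k else j} := by
    ext ω
    simp only [Set.mem_preimage, Set.mem_singleton_iff, Set.mem_ofPred_eq]
    constructor
    · rintro rfl k hk
      rw [if_pos (by omega)]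
      exact (extendPath_of_lt (Z ω) (by omega)).symm
    · intro h
      refine funext fun k => ?_
      have := h k (by omega)
      rw [if_pos k.2, extendPath_of_lt _ k.2] at this
      exact this
  rw [e1, e2, hM, if_pos (Nat.lt_succ_self t), if_neg (lt_irrefl _),
    extendPath_of_lt _ (Nat.lt_succ_self t)]
  rw [show (⟨t, Nat.lt_succ_self t⟩ : Fin (t + 1)) = Fin.last t from rfl]
  ring

/-- The Markov property of the joint AoI and channel process. -/
lemma lintegral_aoi_succ (π : Policy N M Mbar) (t : ℕ) (G : (Fin N → ℕ) → Fin Mbar → ENNReal) :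
    ∫⁻ ω, G (aoi c π (fun k => R.h k ω) (t + 2)) (R.h (t + 1) ω) ∂μ =
      ∫⁻ ω, ∑ j, ENNReal.ofReal (c.P (R.h t ω) j) *
        G (nextAoi c π (aoi c π (fun k => R.h k ω) (t + 1)) (R.h t ω) j) j ∂μ := by
  simp only [aoi_add_two]
  refine hR.lintegral_path_succ t
    (F := fun s j => G (nextAoi c π (aoi c π s (t + 1)) (s t) j) j) fun s s' h => ?_
  funext j
  simp only [aoi_congr c π h, h t (Nat.lt_succ_self t)]

lemma measurable_aoi (π : Policy N M Mbar) (t : ℕ) :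
    Measurable fun ω => aoi c π (fun k => R.h k ω) t :=
  (R.measurable_of_path t fun _ _ h => aoi_congr c π fun k hk => h k (by omega)).mono
    (hR.sigma_le .channel) le_rfl

end IsModel

end Realization

end RemoteEstimation

/-! ### Second moments and reduction of the error to the age -/

namespace RemoteEstimation

section SecondMoment

variable {Ω : Type*} [MeasurableSpace Ω] {μ : Measure Ω} {k l : ℕ}

/-- The random vector `X` is square integrable with second moment matrix `Q`. -/
structure HasSecondMoment (X : Ω → Fin l → ℝ) (Q : Matrix (Fin l) (Fin l) ℝ) (μ : Measure Ω) :
    Prop where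
  memLp : ∀ i, MemLp (fun ω => X ω i) 2 μ
  integral_mul : ∀ i j, ∫ ω, X ω i * X ω j ∂μ = Q i j

namespace HasSecondMoment

variable {X Y : Ω → Fin l → ℝ} {Q Q' : Matrix (Fin l) (Fin l) ℝ}

lemma integrable_mul (hX : HasSecondMoment X Q μ) (i j : Fin l) :
    Integrable (fun ω => X ω i * X ω j) μ := (hX.memLp i).integrable_mul (hX.memLp j)

lemma mulVec (hX : HasSecondMoment X Q μ) (B : Matrix (Fin k) (Fin l) ℝ) :
    HasSecondMoment (fun ω => B.mulVec (X ω)) (B * Q * B.transpose) μ where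
  memLp i := by
    simp only [Matrix.mulVec, dotProduct]
    exact memLp_finsetSum _ fun j _ => (hX.memLp j).const_mul _
  integral_mul i j := by
    simp only [Matrix.mulVec, dotProduct, Finset.sum_mul_sum]
    rw [integral_finsetSum _ fun a _ => integrable_finsetSum _ fun b _ => by
      simpa only [mul_mul_mul_comm] using (hX.integrable_mul a b).const_mul (B i a * B j b)]
    simp only [Matrix.mul_apply, Matrix.transpose_apply, Finset.sum_mul]
    rw [Finset.sum_comm]
    refine Finset.sum_congr rfl fun a _ => ?_
    rw [integral_finsetSum _ fun b _ => by
      simpa only [mul_mul_mul_comm] using (hX.integrable_mul a b).const_mul (B i a * B j b)]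
    refine Finset.sum_congr rfl fun b _ => ?_
    rw [← hX.integral_mul, mul_right_comm, ← integral_const_mul]
    exact integral_congr_ae (ae_of_all _ fun ω => by ring)

lemma integral_mulVec_eq_zero [IsFiniteMeasure μ] (hX : HasSecondMoment X Q μ)
    (h0 : ∀ i, ∫ ω, X ω i ∂μ = 0) (B : Matrix (Fin k) (Fin l) ℝ) (i : Fin k) :
    ∫ ω, B.mulVec (X ω) i ∂μ = 0 := by
  simp only [Matrix.mulVec, dotProduct]
  rw [integral_finsetSum _ fun j _ => ((hX.memLp j).integrable one_le_two).const_mul _]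
  simp [integral_const_mul, h0]

/-- Only Y has to be centred for the cross terms to vanish. This matters because the initial filter
error has a prescribed second moment but no prescribed mean. -/
lemma add_of_indepFun (hX : HasSecondMoment X Q μ) (hY : HasSecondMoment Y Q' μ)
    (hXY : IndepFun X Y μ) (hY0 : ∀ i, ∫ ω, Y ω i ∂μ = 0) :
    HasSecondMoment (fun ω => X ω + Y ω) (Q + Q') μ where
  memLp i := (hX.memLp i).add (hY.memLp i)
  integral_mul i j := by
    have hcross : ∀ a b, ∫ ω, X ω a * Y ω b ∂μ = 0 := by
      intro a b
      have := (hXY.comp (measurable_pi_apply a) (measurable_pi_apply b)).integral_fun_mul_eq_mul_integral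
        (hX.memLp a).aestronglyMeasurable (hY.memLp b).aestronglyMeasurable
      simpa [hY0] using this
    have hi : ∀ a b, Integrable (fun ω => X ω a * Y ω b) μ := fun a b =>
      (hX.memLp a).integrable_mul (hY.memLp b)
    have h1 : ∀ ω, (X ω + Y ω) i * (X ω + Y ω) j =
        (X ω i * X ω j + X ω i * Y ω j) + (X ω j * Y ω i + Y ω i * Y ω j) := fun ω => by
      simp only [Pi.add_apply]; ring
    have e1 : ∫ ω, (X ω i * X ω j + X ω i * Y ω j) ∂μ = Q i j := by
      rw [integral_add (hX.integrable_mul i j) (hi i j), hcross, hX.integral_mul, add_zero]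
    have e2 : ∫ ω, (X ω j * Y ω i + Y ω i * Y ω j) ∂μ = Q' i j := by
      rw [integral_add (hi j i) (hY.integrable_mul i j), hcross, hY.integral_mul, zero_add]
    have e3 : ∫ ω, ((X ω i * X ω j + X ω i * Y ω j) + (X ω j * Y ω i + Y ω i * Y ω j)) ∂μ =
        Q i j + Q' i j := by
      rw [← e1, ← e2]
      exact integral_add ((hX.integrable_mul i j).add (hi i j)) ((hi j i).add (hY.integrable_mul i j))
    simp only [h1]
    exact e3

lemma lintegral_trace (hX : HasSecondMoment X Q μ) :
    ∫⁻ ω, ENNReal.ofReal (Matrix.vecMulVec (X ω) (X ω)).trace ∂μ = ENNReal.ofReal Q.trace := by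
  simp only [Matrix.trace, Matrix.diag_apply, Matrix.vecMulVec_apply]
  rw [← ofReal_integral_eq_lintegral_ofReal (integrable_finsetSum _ fun i _ => hX.integrable_mul i i)
    (ae_of_all _ fun ω => Finset.sum_nonneg fun i _ => mul_self_nonneg _),
    integral_finsetSum _ fun i _ => hX.integrable_mul i i]
  simp only [hX.integral_mul]

end HasSecondMoment

lemma hasSecondMoment_of_hasLaw_multivariateGaussian {X : Ω → Fin l → ℝ}
    {Q : Matrix (Fin l) (Fin l) ℝ} (hQ : Q.PosSemidef)
    (h : HasLaw (fun ω => WithLp.toLp 2 (X ω)) (multivariateGaussian 0 Q) μ) :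
    HasSecondMoment X Q μ ∧ ∀ i, ∫ ω, X ω i ∂μ = 0 := by
  have hmem : ∀ i, MemLp (fun x : EuclideanSpace ℝ (Fin l) => x i) 2 (multivariateGaussian 0 Q) :=
    fun i => (IsGaussian.memLp_two_id (μ := multivariateGaussian 0 Q)).eval_piLp i
  have hmean : ∀ i, ∫ x : EuclideanSpace ℝ (Fin l), x i ∂(multivariateGaussian 0 Q) = 0 := by
    intro i
    have := (EuclideanSpace.proj i : EuclideanSpace ℝ (Fin l) →L[ℝ] ℝ).integral_comp_comm
      (IsGaussian.integrable_id (μ := multivariateGaussian (0 : EuclideanSpace ℝ (Fin l)) Q))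
    simpa using this
  refine ⟨⟨fun i => ?_, fun i j => ?_⟩, fun i => ?_⟩
  · have := hmem i
    rw [← h.map_eq] at this
    exact (memLp_map_measure_iff this.aestronglyMeasurable h.aemeasurable).1 this
  · have h1 := h.integral_comp (f := fun x : EuclideanSpace ℝ (Fin l) => x i * x j)
      ((hmem i).aestronglyMeasurable.mul (hmem j).aestronglyMeasurable)
    have h2 := covariance_eval_multivariateGaussian (μ := 0) hQ i j
    rw [covariance_eq_sub (hmem i) (hmem j), hmean, zero_mul, sub_zero] at h2
    exact h1.trans h2
  · exact (h.integral_comp (f := fun x : EuclideanSpace ℝ (Fin l) => x i)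
      (hmem i).aestronglyMeasurable).trans (hmean i)

end SecondMoment

/-- Averaging a family of random variables, evaluated at an independent bounded random index. -/
lemma lintegral_random_index {Ω : Type*} {m₁ : MeasurableSpace Ω} {mf : ℕ → MeasurableSpace Ω}
    {mΩ : MeasurableSpace Ω} {μ : Measure Ω} (hm₁ : m₁ ≤ mΩ) (hmf : ∀ k, mf k ≤ mΩ) [IsProbabilityMeasure μ]
    {a : Ω → ℕ} (ham : Measurable[m₁] a) {T : ℕ} (haT : ∀ ω, a ω ≤ T) {f : ℕ → Ω → ENNReal}
    (hf : ∀ k, Measurable[mf k] (f k)) (hind : ∀ k, Indep m₁ (mf k) μ) :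
    ∫⁻ ω, f (a ω) ω ∂μ = ∫⁻ ω, ∫⁻ ω', f (a ω) ω' ∂μ ∂μ := by
  have hia : ∀ k, Measurable[m₁] ((a ⁻¹' {k}).indicator (1 : Ω → ENNReal)) := fun k =>
    Measurable.indicator (@measurable_one _ _ _ m₁ _) (ham (measurableSet_singleton k))
  -- Splitting over the finitely many values of the index freezes it, after which independence
  -- applies to each summand separately.
  have hsplit : ∀ g : ℕ → Ω → ENNReal, (∀ k, Measurable (g k)) →
      ∫⁻ ω, g (a ω) ω ∂μ =
        ∑ k ∈ Finset.range (T + 1), ∫⁻ ω, (a ⁻¹' {k}).indicator 1 ω * g k ω ∂μ := by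
    intro g hg
    have hm : ∀ k ∈ Finset.range (T + 1),
        Measurable fun ω => (a ⁻¹' {k}).indicator (1 : Ω → ENNReal) ω * g k ω := fun k _ =>
      ((hia k).mono hm₁ le_rfl).mul (hg k)
    rw [← lintegral_finsetSum _ hm]
    refine lintegral_congr fun ω => ?_
    rw [Finset.sum_eq_single (a ω)]
    · simp
    · intro k _ hk
      rw [Set.indicator_of_notMem (by simpa using hk.symm), zero_mul]
    · intro h
      exact absurd (Finset.mem_range.2 (Nat.lt_succ_of_le (haT ω))) h
  rw [hsplit f fun k => (hf k).mono (hmf k) le_rfl,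
    hsplit (fun k _ => ∫⁻ ω', f k ω' ∂μ) fun k => measurable_const]
  refine Finset.sum_congr rfl fun k _ => ?_
  rw [lintegral_mul_eq_lintegral_mul_lintegral_of_independent_measurableSpace hm₁ (hmf k)
    (hind k) (hia k) (hf k), lintegral_mul_const _ ((hia k).mono hm₁ le_rfl)]

namespace Realization

variable {N M Mbar : ℕ} {p : Fin N → LTIProcess} {Ω : Type*}

section Dynamics

variable (R : Realization p Mbar Ω)

/-- Sources that drive process `n` and its filter: initial condition, process noise before `a` and
measurement noise before `b`. -/
def pastSources (n : Fin N) (a b : ℕ) : Set (Source N) :=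
  {i | i = .initial n ∨ (∃ t < a, i = .processNoise n t) ∨ ∃ t < b, i = .measurementNoise n t}

/-- Estimation error of the local filter. -/
noncomputable def filterErr (n : Fin N) (s : ℕ) (ω : Ω) : Fin (p n).l → ℝ := R.xs n s ω - R.x n s ω

/-- Estimation error `k` steps after the last reception of a local estimate, from time `s`. -/
noncomputable def openLoopErr (n : Fin N) (s : ℕ) : ℕ → Ω → Fin (p n).l → ℝ
  | 0 => R.filterErr n s
  | k + 1 => fun ω => (p n).A.mulVec (openLoopErr n s k ω) - R.w n (s + k) ω

lemma filterErr_succ (n : Fin N) (s : ℕ) (ω : Ω) :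
    R.filterErr n (s + 1) ω =
      ((1 - (p n).gain (p n).Pbar * (p n).C) * (p n).A).mulVec (R.filterErr n s ω) +
        (-(1 - (p n).gain (p n).Pbar * (p n).C)).mulVec (R.w n s ω) +
          ((p n).gain (p n).Pbar).mulVec (R.v n (s + 1) ω) := by
  simp only [filterErr, xs, y, x, ← Matrix.mulVec_mulVec, Matrix.sub_mulVec, Matrix.neg_mulVec,
    Matrix.mulVec_add, Matrix.mulVec_sub, Matrix.one_mulVec]
  abel

/-- A reception restarts the open-loop error from the local filter, a failure prolongs it by one
step. The truncated subtraction is genuine since the age never exceeds t. -/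
lemma err_eq_openLoopErr (c : Channel M Mbar) (π : Policy N M Mbar) (n : Fin N) (t : ℕ) (ω : Ω) :
    R.err c π n t ω = R.openLoopErr n (t - aoi c π (fun k => R.h k ω) t n)
      (aoi c π (fun k => R.h k ω) t n) ω := by
  induction t with
  | zero => rfl
  | succ t ih =>
    have hle := aoi_le c π (fun k => R.h k ω) t n
    by_cases h : received c π (fun k => R.h k ω) (aoi c π (fun k => R.h k ω) t) t n
    · have h1 : aoi c π (fun k => R.h k ω) (t + 1) n = 1 := by simp only [aoi, if_pos h]
      have h2 : R.xhat c π n (t + 1) ω = (p n).A.mulVec (R.xs n t ω) := by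
        simp only [xhat, if_pos h]
      rw [h1, err, h2]
      simp only [Nat.add_sub_cancel, openLoopErr, filterErr, x, Nat.add_zero, Matrix.mulVec_sub]
      abel
    · have h1 : aoi c π (fun k => R.h k ω) (t + 1) n = aoi c π (fun k => R.h k ω) t n + 1 := by
        simp only [aoi, if_neg h]
      have h2 : R.xhat c π n (t + 1) ω = (p n).A.mulVec (R.xhat c π n t ω) := by
        simp only [xhat, if_neg h]
      rw [h1, err, h2, Nat.add_sub_add_right]
      simp only [openLoopErr]
      rw [← ih, Nat.sub_add_cancel hle, err]
      simp only [x, Matrix.mulVec_sub]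
      abel

end Dynamics

lemma measurable_mulVec {m : MeasurableSpace Ω} {k l : ℕ} {X : Ω → Fin l → ℝ} (hX : Measurable X)
    (B : Matrix (Fin k) (Fin l) ℝ) : Measurable fun ω => B.mulVec (X ω) := by
  refine measurable_pi_lambda _ fun i => ?_
  simp only [Matrix.mulVec, dotProduct]
  exact Finset.measurable_sum _ fun j _ => ((measurable_pi_apply j).comp hX).const_mul _

section Measurability

variable (R : Realization p Mbar Ω)

lemma measurable_of_mem_sources {α : Type*} [MeasurableSpace α] {S : Set (Source N)}
    {i : Source N} (hi : i ∈ S) {X : Ω → α} (hX : Measurable[R.sigma i] X) :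
    Measurable[⨆ i ∈ S, R.sigma i] X :=
  hX.mono (le_iSup₂ (f := fun i (_ : i ∈ S) => R.sigma i) i hi) le_rfl

lemma pastSources_mono (n : Fin N) {a a' b b' : ℕ} (ha : a ≤ a') (hb : b ≤ b') :
    (pastSources n a b : Set (Source N)) ⊆ pastSources n a' b' := by
  rintro i (h | ⟨t, ht, h⟩ | ⟨t, ht, h⟩)
  · exact Or.inl h
  · exact Or.inr (Or.inl ⟨t, ht.trans_le ha, h⟩)
  · exact Or.inr (Or.inr ⟨t, ht.trans_le hb, h⟩)

lemma measurable_w_sources {S : Set (Source N)} {n : Fin N} {t : ℕ}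
    (h : Source.processNoise n t ∈ S) : Measurable[⨆ i ∈ S, R.sigma i] (R.w n t) :=
  R.measurable_of_mem_sources h (comap_measurable _)

lemma measurable_v_sources {S : Set (Source N)} {n : Fin N} {t : ℕ}
    (h : Source.measurementNoise n t ∈ S) : Measurable[⨆ i ∈ S, R.sigma i] (R.v n t) :=
  R.measurable_of_mem_sources h (comap_measurable _)

/-- The filter at time s has already used the measurement at s but not the process noise at s,
whence the two different cut-offs. -/
lemma measurable_filterErr (n : Fin N) (s : ℕ) :
    ∀ {S : Set (Source N)}, pastSources n s (s + 1) ⊆ S →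
      Measurable[⨆ i ∈ S, R.sigma i] (R.filterErr n s) := by
  induction s with
  | zero =>
    intro S hS
    have hi : Source.initial n ∈ S := hS (Or.inl rfl)
    exact (R.measurable_of_mem_sources hi ((comap_measurable (R.xs0 n)).mono le_sup_right le_rfl)).sub
      (R.measurable_of_mem_sources hi ((comap_measurable (R.x0 n)).mono le_sup_left le_rfl))
  | succ s ih =>
    intro S hS
    rw [show R.filterErr n (s + 1) = _ from funext fun ω => R.filterErr_succ n s ω]
    refine Measurable.add (Measurable.add (measurable_mulVec (ih ?_) _)
      (measurable_mulVec (R.measurable_w_sources (hS ?_)) _))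
      (measurable_mulVec (R.measurable_v_sources (hS ?_)) _)
    · exact (pastSources_mono n (by omega) (by omega)).trans hS
    · exact Or.inr (Or.inl ⟨s, by omega, rfl⟩)
    · exact Or.inr (Or.inr ⟨s + 1, by omega, rfl⟩)

lemma measurable_openLoopErr (n : Fin N) (s k : ℕ) :
    ∀ {S : Set (Source N)}, pastSources n (s + k) (s + 1) ⊆ S →
      Measurable[⨆ i ∈ S, R.sigma i] (R.openLoopErr n s k) := by
  induction k with
  | zero => exact fun hS => R.measurable_filterErr n s hS
  | succ k ih =>
    intro S hS
    refine Measurable.sub (measurable_mulVec (ih ?_) _) (R.measurable_w_sources (hS ?_))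
    · exact (pastSources_mono n (by omega) le_rfl).trans hS
    · exact Or.inr (Or.inl ⟨s + k, by omega, rfl⟩)

end Measurability

namespace IsModel

variable [MeasurableSpace Ω] {R : Realization p Mbar Ω} {c : Channel M Mbar} {μ : Measure Ω}
variable (hR : R.IsModel c μ)
include hR

lemma indep_sources {S T : Set (Source N)} (h : Disjoint S T) :
    Indep (⨆ i ∈ S, R.sigma i) (⨆ i ∈ T, R.sigma i) μ :=
  indep_iSup_of_disjoint hR.sigma_le hR.indep h

lemma indepFun_of_sources {α β : Type*} [MeasurableSpace α] [MeasurableSpace β]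
    {S T : Set (Source N)} (h : Disjoint S T) {X : Ω → α} {Y : Ω → β}
    (hX : Measurable[⨆ i ∈ S, R.sigma i] X) (hY : Measurable[⨆ i ∈ T, R.sigma i] Y) :
    IndepFun X Y μ :=
  (IndepFun_iff_Indep X Y μ).2 (indep_of_indep_of_le_left
    (indep_of_indep_of_le_right (hR.indep_sources h) hY.comap_le) hX.comap_le)

variable [IsProbabilityMeasure μ]

/-- Each step adds fresh independent centred noises, and the Joseph form says that the resulting
second moment recursion fixes `Pbar`. -/
lemma hasSecondMoment_filterErr {n : Fin N} (hp : (p n).IsSteadyStable) (s : ℕ) :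
    HasSecondMoment (R.filterErr n s) (p n).Pbar μ := by
  induction s with
  | zero => exact ⟨hR.memLp_initial n, hR.cov_initial n⟩
  | succ s ih =>
    obtain ⟨hw, hw0⟩ := hasSecondMoment_of_hasLaw_multivariateGaussian hp.posSemidef_W (hR.law_w n s)
    obtain ⟨hv, hv0⟩ :=
      hasSecondMoment_of_hasLaw_multivariateGaussian hp.posSemidef_V (hR.law_v n (s + 1))
    set K := (p n).gain (p n).Pbar with hK
    set B := 1 - K * (p n).C with hB
    have m1 : Measurable[⨆ i ∈ pastSources n s (s + 1), R.sigma i]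
        fun ω => (B * (p n).A).mulVec (R.filterErr n s ω) :=
      measurable_mulVec (R.measurable_filterErr n s subset_rfl) _
    have m2 : Measurable[⨆ i ∈ ({Source.processNoise n s} : Set (Source N)), R.sigma i]
        fun ω => (-B).mulVec (R.w n s ω) :=
      measurable_mulVec (R.measurable_w_sources (Set.mem_singleton _)) _
    have m3 : Measurable[⨆ i ∈ pastSources n (s + 1) (s + 1), R.sigma i]
        fun ω => (B * (p n).A).mulVec (R.filterErr n s ω) + (-B).mulVec (R.w n s ω) :=
      (measurable_mulVec (R.measurable_filterErr n s (pastSources_mono n (by omega) le_rfl)) _).add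
        (measurable_mulVec (R.measurable_w_sources (Or.inr (Or.inl ⟨s, by omega, rfl⟩))) _)
    have m4 : Measurable[⨆ i ∈ ({Source.measurementNoise n (s + 1)} : Set (Source N)), R.sigma i]
        fun ω => K.mulVec (R.v n (s + 1) ω) :=
      measurable_mulVec (R.measurable_v_sources (Set.mem_singleton _)) _
    have h1 := (ih.mulVec (B * (p n).A)).add_of_indepFun (hw.mulVec (-B))
      (hR.indepFun_of_sources (by simp [pastSources]) m1 m2) (hw.integral_mulVec_eq_zero hw0 _)
    have h2 := h1.add_of_indepFun (hv.mulVec K)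
      (hR.indepFun_of_sources (by simp [pastSources]) m3 m4) (hv.integral_mulVec_eq_zero hv0 _)
    rw [show R.filterErr n (s + 1) = _ from funext fun ω => R.filterErr_succ n s ω]
    convert! h2 using 1
    conv_lhs => rw [← hp.joseph]
    rw [← hK, ← hB, LTIProcess.priorCov]
    simp only [Matrix.transpose_neg, Matrix.neg_mul, Matrix.mul_neg, neg_neg, Matrix.transpose_mul,
      Matrix.mul_add, Matrix.add_mul, Matrix.mul_assoc]

lemma hasSecondMoment_openLoopErr {n : Fin N} (hp : (p n).IsSteadyStable) (s k : ℕ) :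
    HasSecondMoment (R.openLoopErr n s k) ((p n).errCov k) μ := by
  induction k with
  | zero => exact hR.hasSecondMoment_filterErr hp s
  | succ k ih =>
    obtain ⟨hw, hw0⟩ :=
      hasSecondMoment_of_hasLaw_multivariateGaussian hp.posSemidef_W (hR.law_w n (s + k))
    have m1 : Measurable[⨆ i ∈ pastSources n (s + k) (s + 1), R.sigma i]
        fun ω => (p n).A.mulVec (R.openLoopErr n s k ω) :=
      measurable_mulVec (R.measurable_openLoopErr n s k subset_rfl) _
    have m2 : Measurable[⨆ i ∈ ({Source.processNoise n (s + k)} : Set (Source N)), R.sigma i]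
        fun ω => (-1 : Matrix (Fin (p n).l) (Fin (p n).l) ℝ).mulVec (R.w n (s + k) ω) :=
      measurable_mulVec (R.measurable_w_sources (Set.mem_singleton _)) _
    have h1 := (ih.mulVec (p n).A).add_of_indepFun (hw.mulVec (-1))
      (hR.indepFun_of_sources (by simp [pastSources]) m1 m2) (hw.integral_mulVec_eq_zero hw0 _)
    rw [LTIProcess.errCov_succ]
    convert! h1 using 1
    · funext ω
      simp [openLoopErr, Matrix.neg_mulVec, sub_eq_add_neg]
    · simp

/-- The mean-square error is the mean of the error covariance trace at the current AoI. -/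
lemma mse_eq {n : Fin N} (hp : (p n).IsSteadyStable) (π : Policy N M Mbar) (t : ℕ) :
    R.mse c μ π n t =
      ∫⁻ ω, ENNReal.ofReal ((p n).errCov (aoi c π (fun k => R.h k ω) t n)).trace ∂μ := by
  have ham : Measurable[R.sigma .channel] fun ω => aoi c π (fun k => R.h k ω) t n :=
    R.measurable_of_path (F := fun s => aoi c π s t n) t fun _ _ h => by
      rw [aoi_congr c π fun k hk => h k (by omega)]
  have hmeas : ∀ k, Measurable[⨆ i ∈ pastSources n (t - k + k) (t - k + 1), R.sigma i] fun ω =>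
      ENNReal.ofReal
        (Matrix.vecMulVec (R.openLoopErr n (t - k) k ω) (R.openLoopErr n (t - k) k ω)).trace := by
    intro k
    simp only [Matrix.trace, Matrix.diag_apply, Matrix.vecMulVec_apply]
    refine ENNReal.measurable_ofReal.comp (Finset.measurable_sum _ fun i _ => ?_)
    have := (measurable_pi_apply i).comp (R.measurable_openLoopErr n (t - k) k subset_rfl)
    exact this.mul this
  -- For a frozen age k the error is a function of noises and initial data of process n only, while
  -- the age is a function of the channel only.
  have hind : ∀ k, Indep (R.sigma .channel)
      (⨆ i ∈ pastSources n (t - k + k) (t - k + 1), R.sigma i) μ := fun k => by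
    have := hR.indep_sources (S := {Source.channel}) (T := pastSources n (t - k + k) (t - k + 1))
      (by simp [pastSources])
    rwa [iSup_singleton] at this
  have h2 := lintegral_random_index (hR.sigma_le .channel)
    (fun k => iSup₂_le fun i _ => hR.sigma_le i) ham (fun ω => aoi_le c π _ t n) hmeas hind
  simp only [(hR.hasSecondMoment_openLoopErr hp _ _).lintegral_trace] at h2
  rw [← h2]
  exact lintegral_congr fun ω => by rw [R.err_eq_openLoopErr]

end IsModel

end Realization

end RemoteEstimation

/-! ### Necessity: divergence of the mean-square error -/

namespace RemoteEstimation

section Cesaro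

lemma le_of_forall_natCast_le_eq_top {x : ENNReal} (h : ∀ B : ℕ, (B : ENNReal) ≤ x) : x = ⊤ := by
  by_contra hx
  obtain ⟨B, hB⟩ := ENNReal.exists_nat_gt hx
  exact absurd (h B) (not_le.2 hB)

/-- Once T exceeds 2t₀, more than half of the terms are at least 2B, so the average is at least B.
-/
lemma limsup_average_eq_top {f : ℕ → ENNReal} (hf : ∀ B : ℕ, ∀ᶠ t in atTop, (B : ENNReal) ≤ f t) :
    limsup (fun T : ℕ => (∑ t ∈ Finset.Icc 1 T, f t) / (T : ENNReal)) atTop = ⊤ := by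
  refine le_of_forall_natCast_le_eq_top fun B => ?_
  obtain ⟨t₀, ht₀⟩ := eventually_atTop.1 (hf (2 * B))
  refine le_trans (le_liminf_of_le (by isBoundedDefault) ?_) liminf_le_limsup
  filter_upwards [eventually_ge_atTop (2 * t₀ + 1)] with T hT
  rw [ENNReal.le_div_iff_mul_le (Or.inl (by norm_cast; omega)) (Or.inl (ENNReal.natCast_ne_top T))]
  calc (B : ENNReal) * T ≤ (T - t₀ : ℕ) * (2 * B : ℕ) := by
        norm_cast
        calc B * T ≤ B * (2 * (T - t₀)) := Nat.mul_le_mul_left _ (by omega)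
          _ = (T - t₀) * (2 * B) := by ring
    _ = ∑ _t ∈ Finset.Icc (t₀ + 1) T, ((2 * B : ℕ) : ENNReal) := by
        rw [Finset.sum_const, Nat.card_Icc, nsmul_eq_mul, Nat.add_sub_add_right]
    _ ≤ ∑ t ∈ Finset.Icc (t₀ + 1) T, f t :=
        Finset.sum_le_sum fun t ht => ht₀ t (by have := (Finset.mem_Icc.1 ht).1; omega)
    _ ≤ ∑ t ∈ Finset.Icc 1 T, f t :=
        Finset.sum_le_sum_of_subset (Finset.Icc_subset_Icc (by omega) le_rfl)

lemma limsup_average_le {f : ℕ → ENNReal} {B : ENNReal} (hf : ∀ t, f (t + 1) ≤ B) :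
    limsup (fun T : ℕ => (∑ t ∈ Finset.Icc 1 T, f t) / (T : ENNReal)) atTop ≤ B := by
  refine limsup_le_of_le (by isBoundedDefault) (Eventually.of_forall fun T => ?_)
  refine ENNReal.div_le_of_le_mul ?_
  calc ∑ t ∈ Finset.Icc 1 T, f t ≤ ∑ _t ∈ Finset.Icc 1 T, B := by
        refine Finset.sum_le_sum fun t ht => ?_
        obtain ⟨k, rfl⟩ := Nat.exists_eq_add_of_le' (Finset.mem_Icc.1 ht).1
        exact hf k
    _ = B * T := by rw [Finset.sum_const, Nat.card_Icc, nsmul_eq_mul, Nat.add_sub_cancel, mul_comm]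

end Cesaro

section Irreducible

variable {Mbar : ℕ}

/-- For an irreducible matrix, sums of sufficiently many iterates of a nonzero nonnegative vector
are uniformly positive. -/
lemma exists_le_sum_pow_mulVec {P : Matrix (Fin Mbar) (Fin Mbar) ℝ} (hP : P.IsIrreducible)
    {x : Fin Mbar → ℝ} (hx : 0 ≤ x) (hx0 : x ≠ 0) :
    ∃ (K : ℕ) (δ : ℝ), 0 < δ ∧ ∀ i, δ ≤ ∑ k ∈ Finset.range K, (P ^ k).mulVec x i := by
  obtain ⟨j, hj⟩ : ∃ j, x j ≠ 0 := Function.ne_iff.1 hx0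
  have hxj : 0 < x j := lt_of_le_of_ne (hx j) (Ne.symm hj)
  have hnn := fun k => pow_nonneg_apply hP.nonneg k
  -- From each state i the coordinate j carrying mass is reached in k i steps; the window runs up to
  -- the largest of these.
  choose k hk0 hk using fun i => (Matrix.isIrreducible_iff_exists_pow_pos hP.nonneg).1 hP i j
  have hterm : ∀ i l, 0 ≤ (P ^ l).mulVec x i := fun i l => mulVec_nonneg (hnn l) hx i
  have hpos : ∀ i, 0 < ∑ l ∈ Finset.range (Finset.univ.sup k + 1), (P ^ l).mulVec x i := by
    intro i
    have h1 : 0 < (P ^ k i).mulVec x i :=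
      (mul_pos (hk i) hxj).trans_le (Finset.single_le_sum (f := fun j => (P ^ k i) i j * x j)
        (fun l _ => mul_nonneg (hnn _ i l) (hx l)) (Finset.mem_univ j))
    exact h1.trans_le (Finset.single_le_sum (f := fun l => (P ^ l).mulVec x i)
      (fun l _ => hterm i l)
      (Finset.mem_range.2 (Nat.lt_succ_of_le (Finset.le_sup (Finset.mem_univ i)))))
  have : Nonempty (Fin Mbar) := ⟨j⟩
  obtain ⟨i₀, hi₀⟩ := Finite.exists_min fun i =>
    ∑ l ∈ Finset.range (Finset.univ.sup k + 1), (P ^ l).mulVec x i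
  exact ⟨_, _, hpos i₀, hi₀⟩

end Irreducible

namespace Realization.IsModel

variable {N M Mbar : ℕ} {p : Fin N → LTIProcess} {Ω : Type*} [MeasurableSpace Ω]
  {R : Realization p Mbar Ω} {c : Channel M Mbar} {μ : Measure Ω} (hR : R.IsModel c μ)
include hR

lemma lintegral_ofReal_pow_mulVec (hP : ∀ i j, 0 ≤ c.P i j) {x : Fin Mbar → ℝ} (hx : 0 ≤ x)
    (s k : ℕ) : ∫⁻ ω, ENNReal.ofReal (x (R.h (s + k) ω)) ∂μ =
      ∫⁻ ω, ENNReal.ofReal ((c.P ^ k).mulVec x (R.h s ω)) ∂μ := by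
  induction k generalizing x with
  | zero => simp
  | succ k ih =>
    rw [← add_assoc, hR.lintegral_path_succ (s + k) (F := fun _ j => ENNReal.ofReal (x j))
      fun _ _ _ => rfl, pow_succ]
    simp only [← Matrix.mulVec_mulVec]
    rw [← ih (mulVec_nonneg hP hx)]
    refine lintegral_congr fun ω => ?_
    rw [Matrix.mulVec, dotProduct, ENNReal.ofReal_sum_of_nonneg fun j _ => mul_nonneg (hP _ j) (hx j)]
    exact Finset.sum_congr rfl fun j _ => (ENNReal.ofReal_mul (hP _ j)).symm

/-- Under irreducibility the expected occupation of the support of `x` is infinite. -/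
lemma eventually_natCast_le_occupation [IsProbabilityMeasure μ] (hP : c.P.IsIrreducible)
    {x : Fin Mbar → ℝ} (hx : 0 ≤ x) (hx0 : x ≠ 0) (B : ENNReal) (hB : B ≠ ⊤) :
    ∀ᶠ t in atTop, B ≤ ∑ s ∈ Finset.range t, ∫⁻ ω, ENNReal.ofReal (x (R.h s ω)) ∂μ := by
  obtain ⟨K, δ, hδ, hK⟩ := exists_le_sum_pow_mulVec hP hx hx0
  -- Every window of K slots contributes at least δ, whatever the state at its beginning.
  have hwin : ∀ s, ENNReal.ofReal δ ≤
      ∑ k ∈ Finset.range K, ∫⁻ ω, ENNReal.ofReal (x (R.h (s + k) ω)) ∂μ := by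
    intro s
    simp only [hR.lintegral_ofReal_pow_mulVec hP.nonneg hx s]
    have hm : ∀ k ∈ Finset.range K,
        Measurable fun ω => ENNReal.ofReal ((c.P ^ k).mulVec x (R.h s ω)) := fun k _ =>
      (measurable_of_finite fun i => ENNReal.ofReal ((c.P ^ k).mulVec x i)).comp (hR.measurable_h s)
    rw [← lintegral_finsetSum _ hm]
    calc ENNReal.ofReal δ = ∫⁻ _ω, ENNReal.ofReal δ ∂μ := by simp
      _ ≤ _ := lintegral_mono fun ω => by
        rw [← ENNReal.ofReal_sum_of_nonneg fun k _ =>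
          mulVec_nonneg (pow_nonneg_apply hP.nonneg k) hx _]
        exact ENNReal.ofReal_le_ofReal (hK _)
  have hmul : ∀ m : ℕ, m * ENNReal.ofReal δ ≤
      ∑ s ∈ Finset.range (m * K), ∫⁻ ω, ENNReal.ofReal (x (R.h s ω)) ∂μ := by
    intro m
    induction m with
    | zero => simp
    | succ m ih =>
      rw [Nat.succ_mul, Finset.sum_range_add, Nat.cast_succ, add_mul, one_mul]
      exact add_le_add ih (hwin _)
  have hδ' : ENNReal.ofReal δ ≠ 0 := by simpa using hδ
  obtain ⟨m, hm⟩ := ENNReal.exists_nat_mul_gt hδ' hB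
  filter_upwards [eventually_ge_atTop (m * K)] with t ht
  exact hm.le.trans ((hmul m).trans (Finset.sum_le_sum_of_subset (Finset.range_mono ht)))

open Classical in
/-- However packet `n` is scheduled, its AoI grows with a probability bounded from below through a
common subinvariant vector of the packet error matrices. -/
lemma mul_lintegral_le_of_subinvariant (hM : 0 < M) (hP : ∀ i j, 0 ≤ c.P i j) {a : ℝ} (ha : 0 ≤ a)
    {x : Fin Mbar → ℝ} (hx : 0 ≤ x) (hax : ∀ v, a • x ≤ (c.E v).mulVec x)
    (π : Policy N M Mbar) (n : Fin N) (t k : ℕ) :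
    ENNReal.ofReal a * ∫⁻ ω, (if k ≤ aoi c π (fun k => R.h k ω) (t + 1) n then
        ENNReal.ofReal (x (R.h t ω)) else 0) ∂μ ≤
      ∫⁻ ω, (if k + 1 ≤ aoi c π (fun k => R.h k ω) (t + 2) n then
        ENNReal.ofReal (x (R.h (t + 1) ω)) else 0) ∂μ := by
  rw [hR.lintegral_aoi_succ π t fun φ i => if k + 1 ≤ φ n then ENNReal.ofReal (x i) else 0,
    ← lintegral_const_mul' _ _ ENNReal.ofReal_ne_top]
  refine lintegral_mono fun ω => ?_
  generalize aoi c π (fun k => R.h k ω) (t + 1) = φ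
  generalize R.h t ω = i
  by_cases hk : k ≤ φ n
  · obtain ⟨m, hm⟩ : ∃ m : Fin M, ∀ j, c.isOn j m = false → nextAoi c π φ i j n = φ n + 1 := by
      cases h : π φ i n with
      | none => exact ⟨⟨0, hM⟩, fun j _ => if_neg (by simp [h])⟩
      | some m => exact ⟨m, fun j hj => if_neg (by simp [h, hj])⟩
    rw [if_pos hk, ← ENNReal.ofReal_mul ha]
    refine (ENNReal.ofReal_le_ofReal (hax (fun _ => m) i)).trans ?_
    rw [Channel.E_mulVec_apply, ENNReal.ofReal_sum_of_nonneg fun j _ =>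
      mul_nonneg (by split_ifs; exacts [le_rfl, hP i j]) (hx j)]
    refine Finset.sum_le_sum fun j _ => ?_
    cases hj : c.isOn j m with
    | true => simp
    | false =>
      rw [hm j hj, if_pos (Nat.succ_le_succ hk), if_neg Bool.false_ne_true,
        ENNReal.ofReal_mul (hP i j)]
  · simp [hk]

open Classical in
-- The one-step bound is iterated j times from time s, where the age condition is void because ages
-- are at least 1.
lemma pow_mul_lintegral_le_of_subinvariant (hM : 0 < M) (hP : ∀ i j, 0 ≤ c.P i j) {a : ℝ}
    (ha : 0 ≤ a) {x : Fin Mbar → ℝ} (hx : 0 ≤ x) (hax : ∀ v, a • x ≤ (c.E v).mulVec x)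
    (π : Policy N M Mbar) (n : Fin N) (s j : ℕ) :
    ENNReal.ofReal a ^ j * ∫⁻ ω, ENNReal.ofReal (x (R.h s ω)) ∂μ ≤
      ∫⁻ ω, (if j + 1 ≤ aoi c π (fun k => R.h k ω) (s + j + 1) n then
        ENNReal.ofReal (x (R.h (s + j) ω)) else 0) ∂μ := by
  induction j with
  | zero =>
    rw [pow_zero, one_mul]
    exact lintegral_mono fun ω => by rw [if_pos (aoi_pos c π _ _ n)]; rfl
  | succ j ih =>
    rw [pow_succ', mul_assoc]
    exact (mul_le_mul_right ih _).trans
      (hR.mul_lintegral_le_of_subinvariant hM hP ha hx hax π n (s + j) (j + 1))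

/-- If the growth of the error covariance is not compensated by the error rate of the channel,
then no policy stabilizes the process. -/
lemma J_eq_top [IsProbabilityMeasure μ] (hM : 0 < M) (hP : c.P.IsIrreducible) {a : ℝ} (ha : 0 ≤ a)
    {x : Fin Mbar → ℝ} (hx : x ∈ stdSimplex ℝ (Fin Mbar))
    (hax : ∀ v, a • x ≤ (c.E v).mulVec x) {n : Fin N} (hp : (p n).IsSteadyStable)
    (hA : 1 ≤ rho (p n).A) (hra : 1 ≤ rho (p n).A ^ 2 * a) (π : Policy N M Mbar) :
    R.J c μ π n = ⊤ := by
  classical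
  obtain ⟨b, hb, htr⟩ := hp.exists_le_trace_errCov hA
  set r := rho (p n).A ^ 2 with hr
  have hr0 : 0 ≤ r := sq_nonneg _
  have hx1 : ∀ i, x i ≤ 1 := fun i =>
    (Finset.single_le_sum (f := x) (fun j _ => hx.1 j) (Finset.mem_univ i)).trans hx.2.le
  have hmse : ∀ t, ENNReal.ofReal b *
      ∑ s ∈ Finset.range (t + 1), ∫⁻ ω, ENNReal.ofReal (x (R.h s ω)) ∂μ ≤
        R.mse c μ π n (t + 1) := by
    intro t
    rw [hR.mse_eq hp]
    have hpt : ∀ ω, ENNReal.ofReal b * ∑ j ∈ Finset.range (t + 1), ENNReal.ofReal r ^ j *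
        (if j + 1 ≤ aoi c π (fun k => R.h k ω) (t + 1) n then
          ENNReal.ofReal (x (R.h t ω)) else 0) ≤
        ENNReal.ofReal ((p n).errCov (aoi c π (fun k => R.h k ω) (t + 1) n)).trace := by
      intro ω
      have hle := aoi_le c π (fun k => R.h k ω) (t + 1) n
      generalize aoi c π (fun k => R.h k ω) (t + 1) n = m at hle ⊢
      refine le_trans ?_ (ENNReal.ofReal_le_ofReal (htr m))
      rw [ENNReal.ofReal_mul hb.le, ENNReal.ofReal_sum_of_nonneg fun j _ => by positivity]
      refine mul_le_mul_right ?_ _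
      -- The geometric sum over j < m is written with indicators of j < m over a deterministic
      -- range, which is long enough because m ≤ t + 1.
      calc _ ≤ ∑ j ∈ Finset.range (t + 1), if j < m then ENNReal.ofReal r ^ j else 0 := by
            refine Finset.sum_le_sum fun j _ => ?_
            by_cases hj : j < m
            · rw [if_pos hj, if_pos (Nat.succ_le_of_lt hj)]
              refine (mul_le_mul_right ?_ _).trans (mul_one _).le
              simpa using hx1 _
            · rw [if_neg hj, if_neg (by omega), mul_zero]
        _ = ∑ j ∈ Finset.range m, ENNReal.ofReal r ^ j := by
            rw [← Finset.sum_filter]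
            refine Finset.sum_congr (Finset.ext fun j => ?_) fun _ _ => rfl
            simp only [Finset.mem_filter, Finset.mem_range]
            omega
        _ = _ := Finset.sum_congr rfl fun j _ => (ENNReal.ofReal_pow hr0 j).symm
    refine le_trans ?_ (lintegral_mono hpt)
    rw [lintegral_const_mul' _ _ ENNReal.ofReal_ne_top]
    refine mul_le_mul_right ?_ _
    have hmeas : ∀ j ∈ Finset.range (t + 1), Measurable fun ω => ENNReal.ofReal r ^ j *
        (if j + 1 ≤ aoi c π (fun k => R.h k ω) (t + 1) n then
          ENNReal.ofReal (x (R.h t ω)) else 0) := by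
      intro j _
      refine Measurable.const_mul (Measurable.ite ?_ ?_ measurable_const) _
      · exact ((measurable_pi_apply n).comp (hR.measurable_aoi π (t + 1))) measurableSet_Ici
      · exact (measurable_of_finite fun i => ENNReal.ofReal (x i)).comp (hR.measurable_h t)
    -- Reversing the occupation sum pairs the term r^j with starting time t - j; the factor (r a)^j
    -- is at least 1 and can be dropped.
    rw [lintegral_finsetSum _ hmeas, ← Finset.sum_range_reflect]
    refine Finset.sum_le_sum fun j hj => ?_
    rw [Finset.mem_range] at hj
    rw [lintegral_const_mul' _ _ (ENNReal.pow_ne_top ENNReal.ofReal_ne_top)]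
    have h1 := hR.pow_mul_lintegral_le_of_subinvariant hM hP.nonneg ha hx.1 hax π n
      (t + 1 - 1 - j) j
    rw [show t + 1 - 1 - j + j = t by omega] at h1
    refine le_trans ?_ (mul_le_mul_right h1 _)
    rw [← mul_assoc, ← mul_pow, ← ENNReal.ofReal_mul hr0]
    refine le_mul_of_one_le_left zero_le (one_le_pow₀ ?_)
    simpa using hra
  refine limsup_average_eq_top fun B => ?_
  have hb0 : ENNReal.ofReal b ≠ 0 := by simpa using hb
  have hev := hR.eventually_natCast_le_occupation hP hx.1 (Channel.ne_zero_of_mem_stdSimplex hx)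
    (B / ENNReal.ofReal b) (ENNReal.div_ne_top (ENNReal.natCast_ne_top B) hb0)
  filter_upwards [hev, eventually_ge_atTop 1] with t ht ht1
  obtain ⟨k, rfl⟩ := Nat.exists_eq_add_of_le' ht1
  refine le_trans ?_ (hmse k)
  calc (B : ENNReal) = ENNReal.ofReal b * (B / ENNReal.ofReal b) :=
        (ENNReal.mul_div_cancel hb0 ENNReal.ofReal_ne_top).symm
    _ ≤ _ := mul_le_mul_right ht _

end Realization.IsModel

end RemoteEstimation

/-! ### Sufficiency: the persistent policy and its Lyapunov function -/

namespace RemoteEstimation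

section PersistentPolicy

variable {N M Mbar : ℕ}

/-- Process `m` has priority over process `n`: its AoI is larger, or equal with a smaller index. -/
def HasPriority (φ : Fin N → ℕ) (m n : Fin N) : Prop := φ n < φ m ∨ (φ m = φ n ∧ m < n)

open Classical in
/-- The processes that have priority over process `n`. -/
noncomputable def queueAhead (φ : Fin N → ℕ) (n : Fin N) : Finset (Fin N) :=
  Finset.univ.filter fun m => HasPriority φ m n

lemma mem_queueAhead {φ : Fin N → ℕ} {m n : Fin N} : m ∈ queueAhead φ n ↔ HasPriority φ m n := by
  simp [queueAhead]

/-- Number of processes that have priority over process `n`. -/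
noncomputable def queueRank (φ : Fin N → ℕ) (n : Fin N) : ℕ := (queueAhead φ n).card

/-- The policy that persistently serves the process of largest AoI, on channel `v i`. -/
noncomputable def persistentPolicy (v : Fin Mbar → Fin M) : Policy N M Mbar := fun φ i n =>
  if queueRank φ n = 0 then some (v i) else none

lemma queueRank_lt {φ : Fin N → ℕ} {m n : Fin N} (h : HasPriority φ m n) :
    queueRank φ m < queueRank φ n := by
  refine Finset.card_lt_card (Finset.ssubset_iff.2 ⟨m, ?_, fun l hl => ?_⟩)
  · rw [mem_queueAhead, HasPriority]
    omega
  · rw [mem_queueAhead]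
    rcases Finset.mem_insert.1 hl with rfl | hl
    · exact h
    · rw [mem_queueAhead] at hl
      unfold HasPriority at hl h ⊢
      omega

lemma hasPriority_or_of_ne (φ : Fin N → ℕ) {m n : Fin N} (h : m ≠ n) :
    HasPriority φ m n ∨ HasPriority φ n m := by
  unfold HasPriority
  omega

lemma eq_of_queueRank_eq_zero {φ : Fin N → ℕ} {m n : Fin N} (hm : queueRank φ m = 0)
    (hn : queueRank φ n = 0) : m = n := by
  by_contra h
  rcases hasPriority_or_of_ne φ h with h | h
  · exact absurd (queueRank_lt h) (by omega)
  · exact absurd (queueRank_lt h) (by omega)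

lemma exists_queueRank_eq_zero [Nonempty (Fin N)] (φ : Fin N → ℕ) : ∃ n, queueRank φ n = 0 := by
  obtain ⟨n, hn⟩ := Finite.exists_min (queueRank φ)
  refine ⟨n, Finset.card_eq_zero.2 (Finset.eq_empty_of_forall_notMem fun m h => ?_)⟩
  exact absurd (queueRank_lt (mem_queueAhead.1 h)) (not_lt.2 (hn m))

lemma queueRank_le (φ : Fin N → ℕ) (n : Fin N) : queueRank φ n ≤ N := by
  simpa [queueRank] using Finset.card_le_univ (queueAhead φ n)

lemma queueRank_add_one (φ : Fin N → ℕ) (n : Fin N) :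
    queueRank (fun l => φ l + 1) n = queueRank φ n := by
  refine congrArg Finset.card (Finset.ext fun m => ?_)
  simp [mem_queueAhead, HasPriority]

/-- The served packet leaves the front and joins the back, so every other rank drops. Since ages are
at least 1, a waiting packet has age at least 2 after the slot and really precedes the served one.
-/
lemma queueRank_served {φ : Fin N → ℕ} (hφ : ∀ n, 1 ≤ φ n) {m n : Fin N} (hm : queueRank φ m = 0)
    (hmn : n ≠ m) : queueRank (fun l => if l = m then 1 else φ l + 1) n + 1 ≤ queueRank φ n := by
  have hmn' : HasPriority φ m n := by
    rcases hasPriority_or_of_ne φ hmn with h | h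
    · exact absurd (queueRank_lt h) (by omega)
    · exact h
  refine Nat.succ_le_of_lt (Finset.card_lt_card (Finset.ssubset_iff.2 ⟨m, ?_, fun l hl => ?_⟩))
  · have := hφ n
    rw [mem_queueAhead, HasPriority, if_neg hmn, if_pos rfl]
    omega
  · rw [mem_queueAhead]
    rcases Finset.mem_insert.1 hl with rfl | hl
    · exact hmn'
    · by_cases hlm : l = m
      · rwa [hlm]
      · rw [mem_queueAhead, HasPriority, if_neg hmn, if_neg hlm] at hl
        unfold HasPriority
        omega

lemma persistentPolicy_isAdmissible (v : Fin Mbar → Fin M) :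
    (persistentPolicy v : Policy N M Mbar).IsAdmissible := by
  intro φ i n n' j hn hn'
  simp only [persistentPolicy, Option.ite_none_right_eq_some] at hn hn'
  exact eq_of_queueRank_eq_zero hn.1 hn'.1

lemma nextAoi_persistentPolicy_of_off (c : Channel M Mbar) {v : Fin Mbar → Fin M} {i j : Fin Mbar}
    (h : c.isOn j (v i) = false) (φ : Fin N → ℕ) :
    nextAoi c (persistentPolicy v) φ i j = fun n => φ n + 1 := by
  funext n
  refine if_neg ?_
  rintro ⟨m, hm, hon⟩
  simp only [persistentPolicy, Option.ite_none_right_eq_some, Option.some.injEq] at hm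
  rw [← hm.2, h] at hon
  cases hon

lemma nextAoi_persistentPolicy_of_on (c : Channel M Mbar) {v : Fin Mbar → Fin M} {i j : Fin Mbar}
    (h : c.isOn j (v i) = true) {φ : Fin N → ℕ} {m : Fin N} (hm : queueRank φ m = 0) :
    nextAoi c (persistentPolicy v) φ i j = fun n => if n = m then 1 else φ n + 1 := by
  funext n
  by_cases hn : n = m
  · subst hn
    rw [if_pos rfl]
    exact if_pos ⟨v i, by simp [persistentPolicy, hm], h⟩
  · rw [if_neg hn]
    refine if_neg ?_
    rintro ⟨l, hl, -⟩
    simp only [persistentPolicy, Option.ite_none_right_eq_some] at hl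
    exact hn (eq_of_queueRank_eq_zero hl.1 hm)

/-- Weighted exponential sum of the AoIs. -/
noncomputable def queueWeight (K r : ℝ) (φ : Fin N → ℕ) : ℝ := ∑ n, K ^ queueRank φ n * r ^ φ n

lemma queueWeight_add_one (K r : ℝ) (φ : Fin N → ℕ) :
    queueWeight K r (fun l => φ l + 1) = r * queueWeight K r φ := by
  simp only [queueWeight, queueRank_add_one, Finset.mul_sum]
  exact Finset.sum_congr rfl fun n _ => by ring

/-- A waiting packet pays r for aging but gains 1/K from its lower rank; the served one has age 1
and rank at most N, which gives the constant. -/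
lemma queueWeight_served_le {K r : ℝ} (hK : 1 ≤ K) (hr : 0 ≤ r) {φ : Fin N → ℕ}
    (hφ : ∀ n, 1 ≤ φ n) {m : Fin N} (hm : queueRank φ m = 0) :
    queueWeight K r (fun l => if l = m then 1 else φ l + 1) ≤
      r / K * queueWeight K r φ + K ^ N * r := by
  have hK0 : 0 < K := zero_lt_one.trans_le hK
  set φ' : Fin N → ℕ := fun l => if l = m then 1 else φ l + 1 with hφ'
  calc queueWeight K r φ' ≤
        ∑ n, (r / K * (K ^ queueRank φ n * r ^ φ n) + if n = m then K ^ N * r else 0) := by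
        refine Finset.sum_le_sum fun n _ => ?_
        by_cases hn : n = m
        · have h1 : φ' n = 1 := if_pos hn
          rw [if_pos hn, h1, pow_one]
          have h2 : K ^ queueRank φ' n ≤ K ^ N := pow_le_pow_right₀ hK (queueRank_le φ' n)
          have h3 : 0 ≤ r / K * (K ^ queueRank φ n * r ^ φ n) := by positivity
          have h4 := mul_le_mul_of_nonneg_right h2 hr
          linarith
        · have h1 : φ' n = φ n + 1 := if_neg hn
          obtain ⟨k, hk⟩ := Nat.exists_eq_add_of_le' ((Nat.le_add_left 1 _).trans
            (queueRank_served hφ hm hn))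
          have h2 : queueRank φ' n ≤ k := by
            have : queueRank φ' n + 1 ≤ queueRank φ n := queueRank_served hφ hm hn
            omega
          rw [if_neg hn, add_zero, h1, hk]
          calc K ^ queueRank φ' n * r ^ (φ n + 1) ≤ K ^ k * r ^ (φ n + 1) := by gcongr
            _ = r / K * (K ^ (k + 1) * r ^ φ n) := by field_simp; ring
    _ = _ := by
        rw [Finset.sum_add_distrib, ← Finset.mul_sum, Finset.sum_ite_eq' Finset.univ m,
          if_pos (Finset.mem_univ m)]
        rfl

lemma pow_le_queueWeight {K r : ℝ} (hK : 1 ≤ K) (hr : 0 ≤ r) (φ : Fin N → ℕ) (n : Fin N) :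
    r ^ φ n ≤ queueWeight K r φ := by
  have hK0 : 0 ≤ K := zero_le_one.trans hK
  refine (le_mul_of_one_le_left (by positivity) (one_le_pow₀ hK)).trans
    (Finset.single_le_sum (f := fun n => K ^ queueRank φ n * r ^ φ n)
      (fun n _ => by positivity) (Finset.mem_univ n))

/-- Lyapunov drift of the AoIs under the persistent policy. -/
lemma exists_drift [Nonempty (Fin N)] {c : Channel M Mbar}
    (hP : c.P ∈ Matrix.rowStochastic ℝ (Fin Mbar)) {v : Fin Mbar → Fin M} {y : Fin Mbar → ℝ}
    (hy : ∀ i, 1 ≤ y i) {s r : ℝ} (hs : 0 ≤ s) (hr : 1 ≤ r) (hrs : r * s < 1)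
    (hv : (c.E v).mulVec y ≤ s • y) :
    ∃ K η D : ℝ, 1 ≤ K ∧ 0 ≤ η ∧ η < 1 ∧ 0 ≤ D ∧
      ∀ (φ : Fin N → ℕ) (i : Fin Mbar), (∀ n, 1 ≤ φ n) →
        ∑ j, c.P i j * (queueWeight K r (nextAoi c (persistentPolicy v) φ i j) * y j) ≤
          η * (queueWeight K r φ * y i) + D := by
  cases isEmpty_or_nonempty (Fin Mbar)
  · exact ⟨1, 0, 0, le_rfl, le_rfl, one_pos, le_rfl, fun φ i => isEmptyElim i⟩
  have hr0 : 0 ≤ r := zero_le_one.trans hr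
  have hy0 : ∀ i, 0 ≤ y i := fun i => zero_le_one.trans (hy i)
  set Y := ∑ i, y i with hY
  have hyY : ∀ i, y i ≤ Y := fun i =>
    Finset.single_le_sum (f := y) (fun j _ => hy0 j) (Finset.mem_univ i)
  have hY1 : 1 ≤ Y := (hy (Classical.arbitrary _)).trans (hyY _)
  have hθ : 0 < 1 - r * s := by linarith
  have hK1 : 1 ≤ 2 * (r * Y) / (1 - r * s) := by
    rw [le_div_iff₀ hθ]
    nlinarith [mul_nonneg hr0 hs]
  -- K is chosen so that successes contribute at most (1 - r s)/2; together with r s from failures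
  -- this gives η = (1 + r s)/2 < 1.
  refine ⟨2 * (r * Y) / (1 - r * s), (1 + r * s) / 2, (2 * (r * Y) / (1 - r * s)) ^ N * r * Y, hK1,
    by positivity, by linarith, by positivity, fun φ i hφ => ?_⟩
  have hrK : r / (2 * (r * Y) / (1 - r * s)) * Y = (1 - r * s) / 2 := by
    field_simp
  set K := 2 * (r * Y) / (1 - r * s) with hK
  have hK0 : 0 < K := zero_lt_one.trans_le hK1
  have hU0 : ∀ ψ : Fin N → ℕ, 0 ≤ queueWeight K r ψ := fun ψ =>
    Finset.sum_nonneg fun n _ => by positivity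
  obtain ⟨m, hm⟩ := exists_queueRank_eq_zero φ
  -- The success bound is added in the failure case as well, where it is harmless, so that its sum
  -- over j is evaluated by the row sum 1 and the failure terms form row i of E(v).
  have hstep : ∀ j, c.P i j * (queueWeight K r (nextAoi c (persistentPolicy v) φ i j) * y j) ≤
      r * queueWeight K r φ * ((if c.isOn j (v i) then 0 else c.P i j) * y j) +
        c.P i j * ((r / K * queueWeight K r φ + K ^ N * r) * Y) := by
    intro j
    have hPij : 0 ≤ c.P i j := Matrix.nonneg_of_mem_rowStochastic hP
    have hB : 0 ≤ r / K * queueWeight K r φ + K ^ N * r := by have := hU0 φ; positivity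
    cases hj : c.isOn j (v i) with
    | false =>
      rw [nextAoi_persistentPolicy_of_off c hj, queueWeight_add_one]
      have h1 : 0 ≤ c.P i j * ((r / K * queueWeight K r φ + K ^ N * r) * Y) := by positivity
      simp only [Bool.false_eq_true, if_false]
      linarith
    | true =>
      rw [nextAoi_persistentPolicy_of_on c hj hm]
      simp only [if_true, zero_mul, mul_zero, zero_add]
      refine mul_le_mul_of_nonneg_left ?_ hPij
      exact mul_le_mul (queueWeight_served_le hK1 hr0 hφ hm) (hyY j) (hy0 j) hB
  refine (Finset.sum_le_sum fun j _ => hstep j).trans ?_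
  rw [Finset.sum_add_distrib, ← Finset.mul_sum, ← Finset.sum_mul,
    Matrix.sum_row_of_mem_rowStochastic hP, one_mul]
  have h1 : r * queueWeight K r φ * ∑ j, (if c.isOn j (v i) then 0 else c.P i j) * y j ≤
      r * queueWeight K r φ * (s * y i) :=
    mul_le_mul_of_nonneg_left (hv i) (mul_nonneg hr0 (hU0 φ))
  have h2 : queueWeight K r φ ≤ queueWeight K r φ * y i := le_mul_of_one_le_right (hU0 φ) (hy i)
  have h3 : (r / K * queueWeight K r φ + K ^ N * r) * Y =
      (1 - r * s) / 2 * queueWeight K r φ + K ^ N * r * Y := by rw [← hrK]; ring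
  rw [h3]
  have h4 := mul_le_mul_of_nonneg_left h2 (by linarith : 0 ≤ (1 - r * s) / 2)
  linarith

end PersistentPolicy

namespace Realization.IsModel

variable {N M Mbar : ℕ} {p : Fin N → LTIProcess} {Ω : Type*} [MeasurableSpace Ω]
  {R : Realization p Mbar Ω} {c : Channel M Mbar} {μ : Measure Ω} (hR : R.IsModel c μ)
  [IsProbabilityMeasure μ]
include hR

/-- Exponential moments of the AoIs stay bounded under the persistent policy. -/
lemma exists_lintegral_pow_aoi_le [Nonempty (Fin N)]
    (hP : c.P ∈ Matrix.rowStochastic ℝ (Fin Mbar)) {v : Fin Mbar → Fin M} {y : Fin Mbar → ℝ}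
    (hy : ∀ i, 1 ≤ y i) {s r : ℝ} (hs : 0 ≤ s) (hr : 1 ≤ r) (hrs : r * s < 1)
    (hv : (c.E v).mulVec y ≤ s • y) :
    ∃ B : ENNReal, B ≠ ⊤ ∧ ∀ t (n : Fin N), ∫⁻ ω, ENNReal.ofReal
      (r ^ aoi c (persistentPolicy (N := N) v) (fun k => R.h k ω) (t + 1) n) ∂μ ≤ B := by
  obtain ⟨K, η, D, hK, hη0, hη1, hD, hdrift⟩ := exists_drift (N := N) hP hy hs hr hrs hv
  have hr0 : 0 ≤ r := zero_le_one.trans hr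
  have hK0 : 0 ≤ K := zero_le_one.trans hK
  have hy0 : ∀ i, 0 ≤ y i := fun i => zero_le_one.trans (hy i)
  have hU0 : ∀ ψ : Fin N → ℕ, 0 ≤ queueWeight K r ψ := fun ψ =>
    Finset.sum_nonneg fun n _ => by positivity
  have hη : 0 < 1 - η := by linarith
  set B₀ := queueWeight K r (fun _ : Fin N => 1) * ∑ i, y i with hB₀
  have hB₀0 : 0 ≤ B₀ := mul_nonneg (hU0 _) (Finset.sum_nonneg fun i _ => hy0 i)
  -- This bound dominates the initial value and is preserved by the drift u ↦ η u + D.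
  set B := B₀ + D / (1 - η) with hB
  have hB0 : 0 ≤ B := by positivity
  have hBη : η * B + D ≤ B := by
    have h1 : (1 - η) * B = (1 - η) * B₀ + D := by rw [hB]; field_simp
    have h2 : 0 ≤ (1 - η) * B₀ := by positivity
    linarith
  have hV : ∀ t, ∫⁻ ω, ENNReal.ofReal (queueWeight K r
      (aoi c (persistentPolicy (N := N) v) (fun k => R.h k ω) (t + 1)) * y (R.h t ω)) ∂μ ≤
        ENNReal.ofReal B := by
    intro t
    induction t with
    | zero =>
      have : ∀ ω, ENNReal.ofReal (queueWeight K r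
          (aoi c (persistentPolicy (N := N) v) (fun k => R.h k ω) (0 + 1)) * y (R.h 0 ω)) ≤
            ENNReal.ofReal B := by
        intro ω
        refine ENNReal.ofReal_le_ofReal ?_
        rw [show aoi c (persistentPolicy (N := N) v) (fun k => R.h k ω) (0 + 1) = fun _ : Fin N => 1 from
          funext fun n => aoi_one c _ _ n]
        have h1 : y (R.h 0 ω) ≤ ∑ i, y i :=
          Finset.single_le_sum (f := y) (fun j _ => hy0 j) (Finset.mem_univ _)
        have h2 := mul_le_mul_of_nonneg_left h1 (hU0 fun _ => 1)
        have h3 : 0 ≤ D / (1 - η) := by positivity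
        linarith
      simpa using lintegral_mono (μ := μ) this
    | succ t ih =>
      rw [hR.lintegral_aoi_succ (persistentPolicy v) t
        fun φ i => ENNReal.ofReal (queueWeight K r φ * y i)]
      have hpt : ∀ ω, ∑ j, ENNReal.ofReal (c.P (R.h t ω) j) * ENNReal.ofReal (queueWeight K r
          (nextAoi c (persistentPolicy v)
            (aoi c (persistentPolicy (N := N) v) (fun k => R.h k ω) (t + 1)) (R.h t ω) j) * y j) ≤
          ENNReal.ofReal η * ENNReal.ofReal (queueWeight K r
            (aoi c (persistentPolicy (N := N) v) (fun k => R.h k ω) (t + 1)) * y (R.h t ω)) +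
              ENNReal.ofReal D := by
        intro ω
        have hpos := aoi_pos c (persistentPolicy v : Policy N M Mbar) (fun k => R.h k ω) t
        generalize aoi c (persistentPolicy v : Policy N M Mbar) (fun k => R.h k ω) (t + 1) = φ
          at hpos ⊢
        rw [← ENNReal.ofReal_mul hη0,
          ← ENNReal.ofReal_add (mul_nonneg hη0 (mul_nonneg (hU0 _) (hy0 _))) hD]
        refine le_trans (le_of_eq ?_) (ENNReal.ofReal_le_ofReal (hdrift φ (R.h t ω) hpos))
        have hPn : ∀ j, 0 ≤ c.P (R.h t ω) j := fun j => Matrix.nonneg_of_mem_rowStochastic hP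
        rw [ENNReal.ofReal_sum_of_nonneg fun j _ =>
          mul_nonneg (hPn j) (mul_nonneg (hU0 _) (hy0 j))]
        exact Finset.sum_congr rfl fun j _ => (ENNReal.ofReal_mul (hPn j)).symm
      refine (lintegral_mono hpt).trans ?_
      rw [lintegral_add_right _ measurable_const, lintegral_const_mul' _ _ ENNReal.ofReal_ne_top,
        lintegral_const, measure_univ, mul_one]
      calc _ ≤ ENNReal.ofReal η * ENNReal.ofReal B + ENNReal.ofReal D := by gcongr
        _ = ENNReal.ofReal (η * B + D) := by
          rw [ENNReal.ofReal_add (by positivity) hD, ENNReal.ofReal_mul hη0]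
        _ ≤ ENNReal.ofReal B := ENNReal.ofReal_le_ofReal hBη
  refine ⟨ENNReal.ofReal B, ENNReal.ofReal_ne_top, fun t n => (lintegral_mono fun ω => ?_).trans (hV t)⟩
  exact ENNReal.ofReal_le_ofReal ((pow_le_queueWeight hK hr0 _ n).trans
    (le_mul_of_one_le_right (hU0 _) (hy _)))

omit [IsProbabilityMeasure μ] hR in
lemma isStabilizable_of_mse_le {π : Policy N M Mbar} (hπ : π.IsAdmissible)
    (h : ∀ n, ∃ B : ENNReal, B ≠ ⊤ ∧ ∀ t, R.mse c μ π n (t + 1) ≤ B) : R.IsStabilizable c μ := by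
  refine ⟨π, hπ, ENNReal.sum_lt_top.2 fun n _ => ?_⟩
  obtain ⟨B, hB, hle⟩ := h n
  exact (limsup_average_le hle).trans_lt hB.lt_top

/-- Stable processes need no transmission. -/
lemma isStabilizable_of_rho_lt_one (hp : ∀ n, (p n).IsSteadyStable) {s : ℝ} (hs : s < 1)
    (h : ∀ n, rho (p n).A ^ 2 < s) : R.IsStabilizable c μ := by
  refine isStabilizable_of_mse_le (π := fun _ _ _ => none) (by intro _ _ _ _ _ h; cases h)
    fun n => ?_
  have hs0 : 0 ≤ s := (sq_nonneg _).trans (h n).le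
  obtain ⟨C, hC, hle⟩ := (hp n).exists_trace_errCov_le (h n)
  refine ⟨ENNReal.ofReal (C * (1 + (1 - s)⁻¹)), ENNReal.ofReal_ne_top, fun t => ?_⟩
  rw [hR.mse_eq (hp n)]
  refine (lintegral_mono fun ω => ENNReal.ofReal_le_ofReal ((hle _).trans
    (mul_le_mul_of_nonneg_left (add_le_add_right
      ((summable_geometric_of_lt_one hs0 hs).sum_le_tsum _ fun j _ => pow_nonneg hs0 j) 1)
        hC))).trans ?_
  rw [tsum_geometric_of_lt_one hs0 hs]
  simp

/-- The persistent policy stabilizes all processes whose growth is compensated by the channel. -/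
lemma isStabilizable_of_superinvariant [Nonempty (Fin N)] (hp : ∀ n, (p n).IsSteadyStable)
    (hP : c.P ∈ Matrix.rowStochastic ℝ (Fin Mbar)) {v : Fin Mbar → Fin M} {y : Fin Mbar → ℝ}
    (hy : ∀ i, 1 ≤ y i) {s r : ℝ} (hs : 0 ≤ s) (hr : 1 < r) (hrs : r * s < 1)
    (hv : (c.E v).mulVec y ≤ s • y) (h : ∀ n, rho (p n).A ^ 2 < r) : R.IsStabilizable c μ := by
  obtain ⟨B, hB, hle⟩ := hR.exists_lintegral_pow_aoi_le hP hy hs hr.le hrs hv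
  refine isStabilizable_of_mse_le (persistentPolicy_isAdmissible v) fun n => ?_
  obtain ⟨C, hC, htr⟩ := (hp n).exists_trace_errCov_le (h n)
  have hr1 : 0 < r - 1 := by linarith
  have hC' : 0 ≤ C * (1 + (r - 1)⁻¹) := by positivity
  refine ⟨ENNReal.ofReal (C * (1 + (r - 1)⁻¹)) * B, ENNReal.mul_ne_top ENNReal.ofReal_ne_top hB,
    fun t => ?_⟩
  rw [hR.mse_eq (hp n)]
  -- For r > 1 the geometric sum is at most r^k / (r - 1), so the error is controlled by the
  -- exponential moment of the age.
  have hpt : ∀ k, ((p n).errCov k).trace ≤ C * (1 + (r - 1)⁻¹) * r ^ k := by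
    intro k
    refine (htr k).trans ?_
    rw [mul_assoc]
    refine mul_le_mul_of_nonneg_left ?_ hC
    have h1 : (1 : ℝ) ≤ r ^ k := one_le_pow₀ hr.le
    rw [geom_sum_eq hr.ne', add_mul, one_mul, div_eq_inv_mul]
    have h2 : (r - 1)⁻¹ * (r ^ k - 1) ≤ (r - 1)⁻¹ * r ^ k :=
      mul_le_mul_of_nonneg_left (by linarith) (by positivity)
    linarith
  refine (lintegral_mono fun ω => (ENNReal.ofReal_le_ofReal (hpt _)).trans
    (ENNReal.ofReal_mul hC').le).trans ?_
  rw [lintegral_const_mul' _ _ ENNReal.ofReal_ne_top]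
  exact mul_le_mul_right (hle t n) _

end Realization.IsModel

end RemoteEstimation

/-! ### Assembly of the theorem -/

theorem theorem1 {N M Mbar : ℕ} (hM : 0 < M) (hMN : M < N)
    (p : Fin N → RemoteEstimation.LTIProcess)
    (hp : ∀ n, (p n).IsSteadyStable)
    (hord : ∀ m n : Fin N, m ≤ n →
      RemoteEstimation.rho (p n).A ^ 2 ≤ RemoteEstimation.rho (p m).A ^ 2)
    (c : RemoteEstimation.Channel M Mbar) (hc : c.IsErgodic)
    {Ω : Type*} [MeasurableSpace Ω] (μ : MeasureTheory.Measure Ω)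
    [MeasureTheory.IsProbabilityMeasure μ]
    (R : RemoteEstimation.Realization p Mbar Ω) (hR : R.IsModel c μ) :
    IsLeast {a : ℝ | ∃ L : ℕ, 1 ≤ L ∧ a = c.lam L} c.lamInf ∧
      (R.IsStabilizable c μ ↔
        RemoteEstimation.rho (p ⟨0, (Nat.zero_le M).trans_lt hMN⟩).A ^ 2 * c.lamInf < 1) := by
  open RemoteEstimation in
  have : NeZero M := ⟨hM.ne'⟩
  have hN : 0 < N := (Nat.zero_le M).trans_lt hMN
  have : Nonempty (Fin N) := ⟨⟨0, hN⟩⟩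
  obtain ⟨ω⟩ := nonempty_of_isProbabilityMeasure μ
  have : Nonempty (Fin Mbar) := ⟨R.h 0 ω⟩
  have hP := hc.irreducible.nonneg
  obtain ⟨a, ha, ⟨x, hx, hax⟩, hsup⟩ := c.exists_growth_rate hP
  have hlam : ∀ L, 1 ≤ L → c.lam L = a := fun L hL => c.lam_eq_of_growth_rate hP ha hx hax hsup hL
  rw [c.lamInf_eq hlam]
  refine ⟨⟨⟨1, le_rfl, (hlam 1 le_rfl).symm⟩, ?_⟩, ?_, fun hlt => ?_⟩
  · rintro _ ⟨L, hL, rfl⟩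
    exact (hlam L hL).ge
  · rintro ⟨π, -, hJ⟩
    by_contra! hge
    -- E(v) is dominated entrywise by the stochastic matrix, so a ≤ 1; then ρ(A_1)² a ≥ 1 forces
    -- ρ(A_1) ≥ 1, as the lower covariance bound requires.
    have ha1 : a ≤ 1 := by
      refine (le_rho_of_smul_le_mulVec (c.E_nonneg hP fun _ => 0) hx.1
        (Channel.ne_zero_of_mem_stdSimplex hx) ha (hax _)).trans ?_
      refine rho_le_of_mulVec_le_smul (c.E_nonneg hP _) (x := 1) (fun _ => one_pos) zero_le_one
        fun i => ?_
      rw [one_smul, Pi.one_apply, ← Matrix.sum_row_of_mem_rowStochastic hc.stochastic i,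
        Channel.E_mulVec_apply]
      refine Finset.sum_le_sum fun j _ => ?_
      rw [Pi.one_apply, mul_one]
      split_ifs
      exacts [hP i j, le_rfl]
    have hA : 1 ≤ rho (p ⟨0, hN⟩).A := by
      have h0 := rho_nonneg (p ⟨0, hN⟩).A
      by_contra! hlt
      have h1 : rho (p ⟨0, hN⟩).A ^ 2 < 1 := pow_lt_one₀ h0 hlt two_ne_zero
      have h2 := mul_le_of_le_one_right (sq_nonneg (rho (p ⟨0, hN⟩).A)) ha1
      linarith
    have htop := hR.J_eq_top hM hc.irreducible ha hx hax (hp _) hA hge π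
    have hsum := Finset.single_le_sum (f := fun n => R.J c μ π n) (fun _ _ => zero_le)
      (Finset.mem_univ (⟨0, hN⟩ : Fin N))
    exact absurd (htop ▸ hsum) (not_le.2 hJ)
  · have hmax : ∀ n, rho (p n).A ^ 2 ≤ rho (p ⟨0, hN⟩).A ^ 2 := fun n =>
      hord _ _ (Fin.mk_le_of_le_val (Nat.zero_le _))
    rcases lt_or_ge (rho (p ⟨0, hN⟩).A ^ 2) 1 with h1 | h1
    · obtain ⟨s, hs1, hs2⟩ := exists_between h1
      exact hR.isStabilizable_of_rho_lt_one hp hs2 fun n => (hmax n).trans_lt hs1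
    · obtain ⟨r, hr1, hr2⟩ : ∃ r, rho (p ⟨0, hN⟩).A ^ 2 < r ∧ r * a < 1 := by
        have hcont : Tendsto (fun r => r * a) 
            (nhdsWithin (rho (p ⟨0, hN⟩).A ^ 2) (Set.Ioi (rho (p ⟨0, hN⟩).A ^ 2)))
            (nhds (rho (p ⟨0, hN⟩).A ^ 2 * a)) :=
          (tendsto_id.mul_const a).mono_left nhdsWithin_le_nhds
        exact (eventually_mem_nhdsWithin.and (hcont.eventually_lt_const hlt)).exists
      have hr0 : 0 < r := by linarith
      obtain ⟨s, hs1, hs2⟩ := exists_between ((lt_div_iff₀' hr0).2 hr2)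
      obtain ⟨v, y, hy, hv⟩ := hsup s hs1
      exact hR.isStabilizable_of_superinvariant hp hc.stochastic hy (ha.trans hs1.le)
        (h1.trans_lt hr1) ((lt_div_iff₀' hr0).1 hs2) hv fun n => (hmax n).trans_lt hr1
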